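/- For $N\ge 1$ let $J_N(E;t)$ be the $N$-colored Jones polynomial of the figure-eight knot $E$, that is, the quantum invariant of $E$ associated with the $N$-dimensional irreducible representation of $\mathfrak{sl}(2;\mathbb{C})$, normalized so that $J_N(\text{unknot};t)=1$. Put $$\Lambda(z):=-\int_0^z\log|2\sin x|\,dx,\qquad \theta(r):=\arccos\bigl(\cos(2\pi r)-\tfrac12\bigr)\in[0,\pi].$$ If $r$ is an irrational real number with $1/6\le|1-r|<1/4$, then $$\limsup_{N\to\infty}\,2\pi\,\frac{\log\bigl|J_N\bigl(E;\exp(2\pi r\sqrt{-1}/N)\bigr)\bigr|}{N}=\frac{2\Lambda\bigl(\pi r+\theta(r)/2\bigr)-2\Lambda\bigl(\pi r-\theta(r)/2\bigr)}{r}.$$ -/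

import Mathlib

/-- The Lobachevsky function `Λ(z) = -∫₀ᶻ log |2 sin x| dx`. -/
noncomputable def lobachevsky (z : ℝ) : ℝ :=
  -∫ x in (0 : ℝ)..z, Real.log |2 * Real.sin x|

/-- `θ(r) = arccos (cos (2πr) - 1/2)`, with values in `[0, π]`. -/
noncomputable def coneTheta (r : ℝ) : ℝ :=
  Real.arccos (Real.cos (2 * Real.pi * r) - 1 / 2)

namespace ColoredJones

/-! Throughout, `K` is a field and `s : K` is a nonzero element, a fourth root `s = t^(1/4)` of the
variable `t` of the colored Jones polynomial. -/

/-- The quantum bracket `{m} = t^(m/2) - t^(-m/2)`. -/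
def bracket {K : Type*} [Field K] (s : K) (m : ℕ) : K :=
  s ^ (2 * (m : ℤ)) - s ^ (-2 * (m : ℤ))

/-- The balanced Gaussian binomial coefficient `{n}! / ({k}! {n-k}!)`, through its Pascal
recursion, so that it also makes sense where some `{m}` vanishes. -/
def qbinom {K : Type*} [Field K] (s : K) : ℕ → ℕ → K
  | _, 0 => 1
  | 0, _ + 1 => 0
  | n + 1, k + 1 =>
      s ^ (2 * ((k : ℤ) + 1)) * qbinom s n (k + 1) + s ^ (-2 * ((n : ℤ) - k)) * qbinom s n k

/-- The matrix of the braiding `V ⊗ V → V ⊗ V` (universal `R`-matrix followed by the flip), where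
`V` is the `N`-dimensional irreducible representation of quantum `sl₂` with weight basis
`e_0, …, e_{N-1}`. The entry `R^{ij}_{kl}` vanishes unless `l = i + m` and `k = j - m` for some
`m ≥ 0`, and is then
`({l}! {N-1-k}!) / ({i}! {m}! {N-1-j}!) *
  t^((i-(N-1)/2)(j-(N-1)/2) - m(i-j)/2 - m(m+1)/4)`;
here `{l}! / ({i}! {m}!)` is a Gaussian binomial coefficient and
`{N-1-k}! / {N-1-j}! = {N-1-j+1} ⋯ {N-1-j+m}`. -/
def rPos {K : Type*} [Field K] (s : K) (N : ℕ) (i j k l : Fin N) : K :=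
  if (i : ℕ) ≤ l ∧ (i : ℕ) + j = k + l then
    let m : ℕ := l - i
    qbinom s l m * (∏ a ∈ Finset.range m, bracket s (N - 1 - j + (a + 1))) *
      s ^ ((2 * (i : ℤ) - N + 1) * (2 * (j : ℤ) - N + 1)
            - 2 * (m : ℤ) * ((i : ℤ) - j) - (m : ℤ) * (m + 1))
  else 0

/-- The matrix of the inverse braiding. The entry `(R⁻¹)^{ij}_{kl}` vanishes unless `l = i - m` and
`k = j + m` for some `m ≥ 0`, and is then
`(-1)^m ({k}! {N-1-l}!) / ({j}! {m}! {N-1-i}!) *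
  t^(-(i-(N-1)/2)(j-(N-1)/2) - m(i-j)/2 + m(m+1)/4)`. -/
def rNeg {K : Type*} [Field K] (s : K) (N : ℕ) (i j k l : Fin N) : K :=
  if (j : ℕ) ≤ k ∧ (i : ℕ) + j = k + l then
    let m : ℕ := k - j
    (-1) ^ m * qbinom s k m * (∏ a ∈ Finset.range m, bracket s (N - 1 - i + (a + 1))) *
      s ^ (-((2 * (i : ℤ) - N + 1) * (2 * (j : ℤ) - N + 1))
            - 2 * (m : ℤ) * ((i : ℤ) - j) + (m : ℤ) * (m + 1))
  else 0

/-- The operator on `V^{⊗(n+1)}` of a braid generator (`true`) or its inverse (`false`) that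
crosses the neighbouring strands `p` and `p + 1`. -/
def crossing {K : Type*} [Field K] (s : K) (N n : ℕ) (c : Fin n × Bool) :
    Matrix (Fin (n + 1) → Fin N) (Fin (n + 1) → Fin N) K := fun x y =>
  if ∀ q : Fin (n + 1), q ≠ c.1.castSucc → q ≠ c.1.succ → x q = y q then
    (if c.2 then rPos s N else rNeg s N)
      (x c.1.castSucc) (x c.1.succ) (y c.1.castSucc) (y c.1.succ)
  else 0

/-- The operator on `V^{⊗(n+1)}` of a braid word on `n + 1` strands. -/
def braidOperator {K : Type*} [Field K] (s : K) (N n : ℕ) (w : List (Fin n × Bool)) :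
    Matrix (Fin (n + 1) → Fin N) (Fin (n + 1) → Fin N) K :=
  (w.map (crossing s N n)).prod

/-- The writhe of a braid word. -/
def writhe {n : ℕ} (w : List (Fin n × Bool)) : ℤ :=
  (w.map fun c => if c.2 then (1 : ℤ) else -1).sum

/-- The `N`-colored Jones polynomial, with value `1` at the unknot, of the knot that is the closure
of the braid word `w`. All strands but the first are closed, with the weight
`μ(a) = t^((2a-N+1)/2)` of the enhancement; the remaining open strand carries an endomorphism of
the irreducible representation `V`, that is a scalar, and this scalar is read off at the extremal
weight vector `e_0`. The power of `t^((N²-1)/4)` corrects the framing. -/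
def ofBraid {K : Type*} [Field K] (s : K) (N n : ℕ) (w : List (Fin n × Bool)) : K :=
  s ^ (-(writhe w * ((N : ℤ) ^ 2 - 1))) *
    ∑ x : Fin (n + 1) → Fin N, if (x 0 : ℕ) = 0 then
      (∏ p : Fin n, s ^ (2 * (2 * ((x p.succ : ℕ) : ℤ) - N + 1))) * braidOperator s N n w x x
    else 0

/-- A braid word whose closure is the figure-eight knot: `σ₁⁻¹ σ₂ σ₁⁻¹ σ₂`. -/
def figureEightBraid : List (Fin 2 × Bool) :=
  [(0, false), (1, true), (0, false), (1, true)]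

/-- `J_N(E; t)`: the `N`-colored Jones polynomial of the figure-eight knot `E` at a nonzero complex
number `t`. It is a Laurent polynomial in `t`, so the choice of the root `t^(1/4)` is immaterial;
the principal one is used. -/
noncomputable def figureEight (N : ℕ) (t : ℂ) : ℂ :=
  ofBraid (t ^ (1 / 4 : ℂ)) N 2 figureEightBraid

end ColoredJones

/-! The braid state sum collapses to the Habiro–Le formula (`doubleSum_eq_sum_prod`), so with w =
2πr the invariant at exp(iw/N) is a sum over k < N of the real products ∏_{j=1}^{k} (2 cos w - 2
cos(wj/N)). Irrationality of r keeps exp(iw/N) away from roots of unity, which makes the q-series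
manipulations legitimate.

The logarithm of the k-th product is a Riemann sum, of size (N/w) W(wk/N) with W(y) = ∫₀^y log|2 cos
w - 2 cos u| du. `logPrimitive_cos` expresses W by the Lobachevsky function. For these r one has 0 <
cos w < 1/2 and w ≤ 5π/2. The maximum P of W over [0, 5π/2] is then attained at 2π - θ, where the
factor passes down through 1 (`exists_logPrimitive_bounds`). Hence |J_N| is at most N exp((N/w)(P +
ε) + C), and 2πP/w is the claimed value.

For the lower bound, let φ = 2π|1 - r|, so that cos φ = cos w. On [φ, 2π - φ] the factors are
nonnegative, so products ending there do not cancel one another. All other products are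
exponentially smaller (`eventually_le_abs_cosProdSum`). The product ending near 2π - θ has nearly
the expected size, provided that no sample point is too close to the zero φ of the factors
(`exists_exp_le_prod`). This holds when Nφ/w stays away from the integers, which happens for at
least one of any two consecutive N (`exists_good_index`); hence the limsup. -/

namespace ColoredJones

/-! ### Gaussian binomials and terminating q-series. -/

section GaussianBinomial

variable {R : Type*} [CommRing R]

/-- The Gaussian binomial coefficient at `q`. -/
def gaussBinom (q : R) : ℕ → ℕ → R
  | _, 0 => 1
  | 0, _ + 1 => 0
  | n + 1, k + 1 => q ^ (k + 1) * gaussBinom q n (k + 1) + gaussBinom q n k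

/-- The `q`-Pochhammer symbol `(x; q)_k`. -/
def qPoch (q x : R) (k : ℕ) : R := ∏ i ∈ Finset.range k, (1 - x * q ^ i)

variable (q : R)

@[simp] theorem gaussBinom_zero_right (n : ℕ) : gaussBinom q n 0 = 1 := by
  cases n <;> rfl

@[simp] theorem gaussBinom_zero_succ (k : ℕ) : gaussBinom q 0 (k + 1) = 0 := rfl

theorem gaussBinom_succ_succ (n k : ℕ) :
    gaussBinom q (n + 1) (k + 1) = q ^ (k + 1) * gaussBinom q n (k + 1) + gaussBinom q n k := rfl

theorem gaussBinom_eq_zero_of_lt {n k : ℕ} (h : n < k) : gaussBinom q n k = 0 := by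
  induction n generalizing k with
  | zero => cases k with
    | zero => omega
    | succ k => rfl
  | succ n ih => cases k with
    | zero => omega
    | succ k => rw [gaussBinom_succ_succ, ih (by omega), ih (by omega)]; ring

@[simp] theorem gaussBinom_self (n : ℕ) : gaussBinom q n n = 1 := by
  induction n with
  | zero => rfl
  | succ n ih => rw [gaussBinom_succ_succ, ih, gaussBinom_eq_zero_of_lt q (by omega)]; ring

@[simp] theorem qPoch_zero (x : R) : qPoch q x 0 = 1 := by simp [qPoch]

theorem qPoch_succ (x : R) (k : ℕ) : qPoch q x (k + 1) = qPoch q x k * (1 - x * q ^ k) := by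
  simp [qPoch, Finset.prod_range_succ]

theorem qPoch_add (x : R) (k l : ℕ) :
    qPoch q x (k + l) = qPoch q x k * qPoch q (x * q ^ k) l := by
  simp only [qPoch, Finset.prod_range_add]
  congr 1
  refine Finset.prod_congr rfl fun i _ => ?_
  rw [pow_add]; ring

theorem qPoch_succ' (x : R) (k : ℕ) :
    qPoch q x (k + 1) = (1 - x) * qPoch q (x * q) k := by
  rw [add_comm, qPoch_add]; simp [qPoch]

/-- The product formula for the Gaussian binomial coefficient. -/
theorem gaussBinom_mul_qPoch (n k : ℕ) :
    gaussBinom q (n + k) k * qPoch q q k = qPoch q (q ^ (n + 1)) k := by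
  induction n generalizing k with
  | zero => simp
  | succ n ihn =>
    induction k with
    | zero => simp
    | succ k ihk =>
      rw [show n + 1 + (k + 1) = (n + 1 + k) + 1 by ring, gaussBinom_succ_succ, add_mul,
        qPoch_succ, show n + 1 + k = n + (k + 1) by ring]
      have h1 := ihn (k + 1)
      have h2 := ihk
      rw [show n + 1 + k = n + (k + 1) by ring] at h2
      rw [qPoch_succ, qPoch_succ'] at h1
      rw [qPoch_succ]
      have e : q ^ (n + 1) * q = q ^ (n + 1 + 1) := by ring
      rw [e] at h1
      have h3 : gaussBinom q (n + (k + 1)) k * (qPoch q q k * (1 - q * q ^ k)) =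
          qPoch q (q ^ (n + 1 + 1)) k * (1 - q * q ^ k) := by rw [← mul_assoc, h2]
      rw [mul_assoc, h1, h3]
      ring

/-- The `q`-binomial theorem. -/
theorem sum_gaussBinom_eq_qPoch (w : R) (k : ℕ) :
    ∑ a ∈ Finset.range (k + 1), gaussBinom q k a * (-1) ^ a * q ^ (a.choose 2) * w ^ a
      = qPoch q w k := by
  induction k generalizing w with
  | zero => simp
  | succ k ih =>
    rw [Finset.sum_range_succ']
    have e : ∀ a ∈ Finset.range (k + 1),
        gaussBinom q (k + 1) (a + 1) * (-1) ^ (a + 1) * q ^ ((a + 1).choose 2) * w ^ (a + 1) =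
        gaussBinom q k (a + 1) * (-1) ^ (a + 1) * q ^ ((a + 1).choose 2) * (w * q) ^ (a + 1)
        - w * (gaussBinom q k a * (-1) ^ a * q ^ (a.choose 2) * (w * q) ^ a) := by
      intro a _
      rw [gaussBinom_succ_succ, Nat.choose_succ_succ' a 1, Nat.choose_one_right]
      ring
    rw [Finset.sum_congr rfl e, Finset.sum_sub_distrib, ← Finset.mul_sum, ih, Finset.sum_range_succ,
      gaussBinom_eq_zero_of_lt q (Nat.lt_succ_self k), qPoch_succ']
    have h := ih (w * q)
    rw [Finset.sum_range_succ'] at h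
    simp only [gaussBinom_zero_right, pow_zero, mul_one, Nat.choose_zero_succ, zero_mul, add_zero]
      at h ⊢
    rw [sub_mul, one_mul, ← h]
    ring

/-- Terminating summation of `q`-Vandermonde type. -/
theorem sum_qPoch_mul_gaussBinom (z y : R) (M : ℕ) (hy : y * z = 1) (hz : z * q ^ M = 1) (k : ℕ) :
    ∑ d ∈ Finset.range (M + 1), qPoch q z d * gaussBinom q (k + d) d * q ^ d = y ^ (k + 1) := by
  -- Summation by parts, from z q^d (z; q)_d = (z; q)_d - (z; q)_{d+1}. The boundary term contains
  -- (z; q)_{M+1}, which vanishes because z q^M = 1.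
  have key : ∀ f : ℕ → R, ∑ d ∈ Finset.range (M + 1), qPoch q z d * f d * q ^ d =
      y * (f 0 + ∑ d ∈ Finset.range M, qPoch q z (d + 1) * (f (d + 1) - f d)) := by
    intro f
    have h1 : ∀ m : ℕ, z * ∑ d ∈ Finset.range (m + 1), qPoch q z d * f d * q ^ d =
        (f 0 + ∑ d ∈ Finset.range m, qPoch q z (d + 1) * (f (d + 1) - f d))
          - qPoch q z (m + 1) * f m := by
      intro m
      induction m with
      | zero => simp [qPoch]; ring
      | succ m ih =>
        rw [Finset.sum_range_succ, mul_add, ih, Finset.sum_range_succ _ m, qPoch_succ q z (m + 1)]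
        ring
    have h2 := h1 M
    rw [qPoch_succ, hz] at h2
    have h3 : ∑ d ∈ Finset.range (M + 1), qPoch q z d * f d * q ^ d =
      y * (z * ∑ d ∈ Finset.range (M + 1), qPoch q z d * f d * q ^ d) := by
      rw [← mul_assoc, hy, one_mul]
    rw [h3, h2]; ring
  induction k with
  | zero =>
    rw [key]; simp
  | succ k ih =>
    rw [key, pow_succ, ← ih, mul_comm _ y, Finset.sum_range_succ']
    congr 1
    rw [add_comm]
    congr 1
    · refine Finset.sum_congr rfl fun d _ => ?_
      -- By Pascal's rule the difference f (d + 1) - f d is q^(d+1) times the binomial belonging to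
      -- k, so the sum for k + 1 is y times the sum for k.
      rw [show k + 1 + (d + 1) = (k + 1 + d) + 1 by ring, gaussBinom_succ_succ,
        show k + 1 + d = k + (d + 1) by ring]
      ring
    · simp

end GaussianBinomial

/-! ### From the double sum to the Habiro–Le sum. -/

section FigureEightSum

variable {K : Type*} [Field K] {q : K}

theorem qPoch_self_ne_zero (hq : ∀ k : ℕ, q ^ (k + 1) ≠ 1) (k : ℕ) : qPoch q q k ≠ 0 := by
  refine Finset.prod_ne_zero_iff.2 fun i _ => ?_
  rw [← pow_succ']
  exact sub_ne_zero.2 (hq i).symm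

theorem gaussBinom_mul_qPoch_mul_qPoch {R : Type*} [CommRing R] (q : R) (n k : ℕ) :
    gaussBinom q (n + k) k * (qPoch q q n * qPoch q q k) = qPoch q q (n + k) := by
  rw [mul_comm (qPoch q q n), ← mul_assoc, gaussBinom_mul_qPoch, qPoch_add, ← pow_succ', mul_comm]

theorem gaussBinom_symm (hq : ∀ k : ℕ, q ^ (k + 1) ≠ 1) (n k : ℕ) :
    gaussBinom q (n + k) k = gaussBinom q (n + k) n := by
  have h1 := gaussBinom_mul_qPoch_mul_qPoch q n k
  have h2 := gaussBinom_mul_qPoch_mul_qPoch q k n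
  rw [add_comm k n, mul_comm (qPoch q q k), ← h1] at h2
  exact (mul_right_cancel₀
    (mul_ne_zero (qPoch_self_ne_zero hq n) (qPoch_self_ne_zero hq k)) h2).symm

theorem gaussBinom_mul_gaussBinom (hq : ∀ k : ℕ, q ^ (k + 1) ≠ 1) (a i d : ℕ) :
    gaussBinom q (a + (i + d)) (i + d) * gaussBinom q (i + d) i =
      gaussBinom q (a + i) i * gaussBinom q (a + i + d) d := by
  have ha := qPoch_self_ne_zero hq a
  have hi := qPoch_self_ne_zero hq i
  have hd := qPoch_self_ne_zero hq d
  have hid := qPoch_self_ne_zero hq (i + d)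
  have hai := qPoch_self_ne_zero hq (a + i)
  have h1 := gaussBinom_mul_qPoch_mul_qPoch q a (i + d)
  have h2 := gaussBinom_mul_qPoch_mul_qPoch q d i
  have h3 := gaussBinom_mul_qPoch_mul_qPoch q a i
  have h4 := gaussBinom_mul_qPoch_mul_qPoch q (a + i) d
  rw [add_comm d i] at h2
  rw [← add_assoc] at h1 ⊢
  rw [eq_div_of_mul_eq (mul_ne_zero ha hid) h1, eq_div_of_mul_eq (mul_ne_zero hd hi) h2,
    eq_div_of_mul_eq (mul_ne_zero ha hi) h3, eq_div_of_mul_eq (mul_ne_zero hai hd) h4]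
  field_simp

/-- One of the two Pochhammer factors is expanded by the q-binomial theorem. With c = i + d, the sum
over d is then terminating and is evaluated by `sum_qPoch_mul_gaussBinom` with base z q^(a+i). -/
theorem sum_gaussBinom_mul_qPoch_sq (hq : ∀ k : ℕ, q ^ (k + 1) ≠ 1)
    (z : K) (M a : ℕ) (hz : z * q ^ (a + M) = 1) :
    ∑ c ∈ Finset.range (M + 1), gaussBinom q (a + c) c * qPoch q (z * q ^ a) c ^ 2 * q ^ c =
      ∑ i ∈ Finset.range (M + 1), gaussBinom q (a + i) i * (-1) ^ i * q ^ (i.choose 2) *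
        (z * q ^ a) ^ i * q ^ i * qPoch q (z * q ^ a) i * (q ^ (M - i)) ^ (a + i + 1) := by
  obtain ⟨F, hF⟩ : ∃ F : ℕ → ℕ → K, ∀ i d, F i d = gaussBinom q (a + (i + d)) (i + d) *
        gaussBinom q (i + d) i * (-1) ^ i * q ^ (i.choose 2) * (z * q ^ a) ^ i *
        qPoch q (z * q ^ a) (i + d) * q ^ (i + d) := ⟨_, fun _ _ => rfl⟩
  have h1 : ∀ c ∈ Finset.range (M + 1),
      gaussBinom q (a + c) c * qPoch q (z * q ^ a) c ^ 2 * q ^ c =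
      ∑ i ∈ Finset.range (c + 1), F i (c - i) := by
    intro c _
    rw [pow_two]
    nth_rewrite 1 [← sum_gaussBinom_eq_qPoch]
    rw [Finset.sum_mul, Finset.mul_sum, Finset.sum_mul]
    refine Finset.sum_congr rfl fun i hi => ?_
    have : i + (c - i) = c := by have := Finset.mem_range.1 hi; omega
    simp only [hF, this]
    ring
  rw [Finset.sum_congr rfl h1, Finset.sum_range_diag_flip]
  refine Finset.sum_congr rfl fun i hi => ?_
  have hi' : i ≤ M := by have := Finset.mem_range.1 hi; omega
  have hz' : z * q ^ a * q ^ i * q ^ (M - i) = 1 := by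
    rw [mul_assoc, mul_assoc, ← pow_add, ← pow_add, ← hz]; congr 3; omega
  rw [show M + 1 - i = (M - i) + 1 by omega,
    ← sum_qPoch_mul_gaussBinom q (z * q ^ a * q ^ i) (q ^ (M - i)) (M - i)
      (by rw [mul_comm]; exact hz') hz' (a + i), Finset.mul_sum]
  refine Finset.sum_congr rfl fun d _ => ?_
  rw [hF, gaussBinom_mul_gaussBinom hq, qPoch_add, pow_add q i d]
  ring

/-- The factors are paired index by index: each pair, with its sign, is q^(j+1) times one Habiro–Le
factor. -/
theorem qPoch_mul_qPoch_eq_prod (hq0 : q ≠ 0) (n k : ℕ) :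
    (-1) ^ k * qPoch q ((q ^ n)⁻¹) k * qPoch q (q ^ (n + 2)) k =
      q ^ ((k + 1).choose 2) * ∏ j ∈ Finset.range k,
        (q ^ (n + 1) + (q ^ (n + 1))⁻¹ - q ^ (j + 1) - (q ^ (j + 1))⁻¹) := by
  induction k with
  | zero => simp
  | succ k ih =>
    rw [qPoch_succ, qPoch_succ, Finset.prod_range_succ, Nat.choose_succ_succ' (k + 1) 1,
      Nat.choose_one_right, pow_add q (k + 1)]
    have e : -((1 - (q ^ n)⁻¹ * q ^ k) * (1 - q ^ (n + 2) * q ^ k)) = q ^ (k + 1) *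
        (q ^ (n + 1) + (q ^ (n + 1))⁻¹ - q ^ (k + 1) - (q ^ (k + 1))⁻¹) := by
      field_simp
      ring
    calc _ = ((-1) ^ k * qPoch q ((q ^ n)⁻¹) k * qPoch q (q ^ (n + 2)) k) *
        (-((1 - (q ^ n)⁻¹ * q ^ k) * (1 - q ^ (n + 2) * q ^ k))) := by ring
      _ = _ := by rw [ih, e]; ring

theorem choose_two_mul_two (m : ℕ) : m.choose 2 * 2 + m = m * m := by
  induction m with
  | zero => rfl
  | succ m ih =>
    rw [Nat.choose_succ_succ' m 1, Nat.choose_one_right]; linarith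

/-- The double sum from the braid is the single sum of Habiro and Le. -/
theorem doubleSum_eq_sum_prod (hq : ∀ k : ℕ, q ^ (k + 1) ≠ 1) (hq0 : q ≠ 0) (n : ℕ) :
    (q ^ n)⁻¹ * ∑ b ∈ Finset.range (n + 1), ∑ a ∈ Finset.range (b + 1),
      qPoch q ((q ^ n)⁻¹) a * q ^ (a * a + 2 * a) * gaussBinom q b (b - a) *
        qPoch q ((q ^ n)⁻¹ * q ^ a) (b - a) ^ 2 * q ^ (b - a) =
    ∑ k ∈ Finset.range (n + 1), ∏ j ∈ Finset.range k,
        (q ^ (n + 1) + (q ^ (n + 1))⁻¹ - q ^ (j + 1) - (q ^ (j + 1))⁻¹) := by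
  set z : K := (q ^ n)⁻¹ with hz
  obtain ⟨F, hF⟩ : ∃ F : ℕ → ℕ → K, ∀ a c, F a c = qPoch q z a * q ^ (a * a + 2 * a) *
    (gaussBinom q (a + c) c * qPoch q (z * q ^ a) c ^ 2 * q ^ c) := ⟨_, fun _ _ => rfl⟩
  obtain ⟨H, hH⟩ : ∃ H : ℕ → ℕ → K, ∀ a i, H a i = qPoch q z a * q ^ (a * a + 2 * a) *
    (gaussBinom q (a + i) i * (-1) ^ i * q ^ (i.choose 2) * (z * q ^ a) ^ i * q ^ i *
      qPoch q (z * q ^ a) i * (q ^ (n - a - i)) ^ (a + i + 1)) := ⟨_, fun _ _ => rfl⟩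
  have h1 : ∀ b ∈ Finset.range (n + 1), ∑ a ∈ Finset.range (b + 1),
      qPoch q z a * q ^ (a * a + 2 * a) * gaussBinom q b (b - a) *
        qPoch q (z * q ^ a) (b - a) ^ 2 * q ^ (b - a) =
      ∑ a ∈ Finset.range (b + 1), F a (b - a) := by
    intro b _
    refine Finset.sum_congr rfl fun a ha => ?_
    have : a + (b - a) = b := by have := Finset.mem_range.1 ha; omega
    simp only [hF, this]
    ring
  rw [Finset.sum_congr rfl h1, Finset.sum_range_diag_flip]
  have h2 : ∀ a ∈ Finset.range (n + 1), ∑ c ∈ Finset.range (n + 1 - a), F a c =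
      ∑ i ∈ Finset.range (n + 1 - a), H a i := by
    intro a ha
    have ha' : a ≤ n := by have := Finset.mem_range.1 ha; omega
    simp only [hF, hH]
    rw [← Finset.mul_sum, ← Finset.mul_sum, show n + 1 - a = n - a + 1 by omega,
      sum_gaussBinom_mul_qPoch_sq hq z (n - a) a]
    rw [show a + (n - a) = n by omega, hz]
    exact inv_mul_cancel₀ (pow_ne_zero _ hq0)
  -- Regrouping by k = a + i: the two Pochhammer symbols multiply to (z; q)_k, and the remaining sum
  -- over a is the q-binomial expansion of (q^(n+2); q)_k.
  rw [Finset.sum_congr rfl h2, ← Finset.sum_range_diag_flip, Finset.mul_sum]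
  refine Finset.sum_congr rfl fun k hk => ?_
  have hk' : k ≤ n := by have := Finset.mem_range.1 hk; omega
  refine mul_left_cancel₀ (pow_ne_zero ((k + 1).choose 2) hq0) ?_
  rw [← qPoch_mul_qPoch_eq_prod hq0, ← sum_gaussBinom_eq_qPoch q (q ^ (n + 2)) k, Finset.mul_sum, Finset.mul_sum,
    Finset.mul_sum]
  refine Finset.sum_congr rfl fun a ha => ?_
  obtain ⟨i, rfl⟩ : ∃ i, k = a + i := ⟨k - a, by have := Finset.mem_range.1 ha; omega⟩
  obtain ⟨m, rfl⟩ : ∃ m, n = a + i + m := ⟨n - (a + i), by omega⟩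
  simp only [hH, show a + i - a = i by omega, show a + i + m - a - i = m by omega]
  rw [gaussBinom_symm hq, qPoch_add q z a i]
  have hs : ((-1 : K)) ^ (a + i) * (-1) ^ a = (-1) ^ i := by
    rw [pow_add, mul_right_comm, ← mul_pow]; simp
  have he : q ^ ((a + i + 1).choose 2) * z * q ^ (a * a + 2 * a) * q ^ (i.choose 2) *
      (z * q ^ a) ^ i * q ^ i * (q ^ m) ^ (a + i + 1) =
      q ^ (a.choose 2) * (q ^ (a + i + m + 2)) ^ a := by
    have hzz : z * q ^ (a + i + m) = 1 := inv_mul_cancel₀ (pow_ne_zero _ hq0)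
    have hexp : (a + i + 1).choose 2 + (a * a + 2 * a) + i.choose 2 + a * i + i +
        m * (a + i + 1) = a.choose 2 + (a + i + m + 2) * a + (a + i + m) * (i + 1) := by
      have e1 := choose_two_mul_two (a + i + 1)
      have e2 := choose_two_mul_two i
      have e3 := choose_two_mul_two a
      nlinarith
    calc _ = z ^ (i + 1) * q ^ ((a + i + 1).choose 2 + (a * a + 2 * a) + i.choose 2 + a * i + i +
        m * (a + i + 1)) := by simp only [pow_add, mul_pow, pow_mul]; ring
      _ = (z * q ^ (a + i + m)) ^ (i + 1) * (q ^ (a.choose 2) * (q ^ (a + i + m + 2)) ^ a) := by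
        rw [hexp, mul_pow, pow_add, pow_add, ← pow_mul, ← pow_mul]; ring
      _ = _ := by rw [hzz]; ring
  calc _ = (q ^ ((a + i + 1).choose 2) * z * q ^ (a * a + 2 * a) * q ^ (i.choose 2) *
      (z * q ^ a) ^ i * q ^ i * (q ^ m) ^ (a + i + 1)) * (qPoch q z a * qPoch q (z * q ^ a) i *
        gaussBinom q (a + i) a * (-1) ^ i) := by ring
    _ = _ := by rw [he, ← hs]; ring

end FigureEightSum

/-! ### Evaluation of the braid state sum. -/

section StateSum

variable {K : Type*} [Field K] {s : K}

theorem pow_four_pow (s : K) (n : ℕ) : (s ^ 4) ^ n = s ^ (4 * (n : ℤ)) := by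
  rw [← pow_mul, ← zpow_natCast]; push_cast; rfl

theorem qbinom_eq_gaussBinom (hs : s ≠ 0) (n k : ℕ) :
    qbinom s n k = s ^ (-2 * (k : ℤ) * (n - k)) * gaussBinom (s ^ 4) n k := by
  induction n generalizing k with
  | zero => cases k <;> simp [qbinom]
  | succ n ih => cases k with
    | zero => simp [qbinom]
    | succ k =>
      rw [qbinom, ih, ih, gaussBinom_succ_succ, mul_add (s ^ _), ← mul_assoc, ← mul_assoc, ← mul_assoc,
        pow_four_pow, ← zpow_add₀ hs, ← zpow_add₀ hs, ← zpow_add₀ hs]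
      congr 3 <;> (push_cast; ring)

theorem prod_bracket_eq_qPoch (hs : s ≠ 0) (n a m : ℕ) (h : a + m ≤ n) :
    ∏ i ∈ Finset.range m, bracket s (n - (a + m) + (i + 1)) =
      s ^ (2 * ((n : ℤ) - a) * m - m * (m - 1)) *
        qPoch (s ^ 4) (((s ^ 4) ^ n)⁻¹ * (s ^ 4) ^ a) m := by
  induction m with
  | zero => simp
  | succ m ih =>
    have e : ∀ i ∈ Finset.range m, bracket s (n - (a + (m + 1)) + (i + 1 + 1)) =
        bracket s (n - (a + m) + (i + 1)) := fun i _ => by congr 1; omega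
    -- Raising m lowers the bottom of the range of brackets, so the new factor sits at index 0 on
    -- the left and at the end of the Pochhammer symbol on the right.
    rw [Finset.prod_range_succ', Finset.prod_congr rfl e, ih (by omega), qPoch_succ]
    have h2 : bracket s (n - (a + (m + 1)) + (0 + 1)) = s ^ (2 * ((n : ℤ) - a - m)) *
        (1 - ((s ^ 4) ^ n)⁻¹ * (s ^ 4) ^ a * (s ^ 4) ^ m) := by
      rw [bracket, mul_sub, mul_one]
      simp only [pow_four_pow, ← zpow_neg, ← zpow_add₀ hs]
      rw [show n - (a + (m + 1)) + (0 + 1) = n - a - m by omega]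
      push_cast [Nat.cast_sub (show a ≤ n by omega), Nat.cast_sub (show m ≤ n - a by omega)]
      congr 2
      ring
    rw [h2]
    calc _ = (s ^ (2 * ((n : ℤ) - a) * m - m * (m - 1)) * s ^ (2 * ((n : ℤ) - a - m))) *
        (qPoch (s ^ 4) (((s ^ 4) ^ n)⁻¹ * (s ^ 4) ^ a) m *
          (1 - ((s ^ 4) ^ n)⁻¹ * (s ^ 4) ^ a * (s ^ 4) ^ m)) := by ring
      _ = _ := by
        rw [← zpow_add₀ hs]
        congr 2
        push_cast
        ring

theorem crossing_zero (N : ℕ) (e : Bool) (x y : Fin 3 → Fin N) :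
    crossing s N 2 (0, e) x y =
      if x 2 = y 2 then (if e then rPos s N else rNeg s N) (x 0) (x 1) (y 0) (y 1) else 0 := by
  simp [crossing, Fin.forall_fin_succ]

theorem crossing_one (N : ℕ) (e : Bool) (x y : Fin 3 → Fin N) :
    crossing s N 2 (1, e) x y =
      if x 0 = y 0 then (if e then rPos s N else rNeg s N) (x 1) (x 2) (y 1) (y 2) else 0 := by
  simp [crossing, Fin.forall_fin_succ]

theorem rPos_ne_zero {N : ℕ} {i j k l : Fin N} (h : rPos s N i j k l ≠ 0) :
    (i : ℕ) ≤ l ∧ (i : ℕ) + j = k + l := by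
  by_contra h'
  exact h (if_neg h')

theorem rNeg_ne_zero {N : ℕ} {i j k l : Fin N} (h : rNeg s N i j k l ≠ 0) :
    (j : ℕ) ≤ k ∧ (i : ℕ) + j = k + l := by
  by_contra h'
  exact h (if_neg h')

/-- Weight conservation and the triangularity of the R-matrices, together with the label 0 on the
open strand at both ends, leave a single intermediate state at each level. -/
theorem braidOperator_figureEightBraid (n : ℕ) (a b : Fin (n + 1)) :
    braidOperator s (n + 1) 2 figureEightBraid ![0, a, b] ![0, a, b] =
      rNeg s (n + 1) 0 a a 0 * (rPos s (n + 1) 0 b 0 b *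
        (rNeg s (n + 1) a 0 0 a * rPos s (n + 1) a b a b)) := by
  simp only [braidOperator, figureEightBraid, List.map_cons, List.map_nil, List.prod_cons,
    List.prod_nil, mul_one]
  -- The last two crossings are read backwards: the final one fixes strand 0, which forces w 0 = 0,
  -- and triangularity of the inverse crossing then gives v 1 = 0.
  have hC : ∀ v w : Fin 3 → Fin (n + 1), v 0 = a → (v 1 : ℕ) + v 2 = b →
      crossing s (n + 1) 2 (0, false) v w * crossing s (n + 1) 2 (1, true) w ![0, a, b] ≠ 0 →
      v = ![a, 0, b] ∧ w = ![0, a, b] := by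
    intro v w h0 h12 h
    have h1 := left_ne_zero_of_mul h
    have h2 := right_ne_zero_of_mul h
    rw [crossing_zero] at h1
    rw [crossing_one] at h2
    have h3 : v 2 = w 2 := by by_contra h'; exact h1 (if_neg h')
    have h4 : w 0 = 0 := by by_contra h'; exact h2 (if_neg h')
    rw [if_pos h3] at h1
    obtain ⟨h5, h6⟩ := rNeg_ne_zero h1
    rw [h4, h0] at h6
    rw [h4] at h5
    have h7 : v 1 = 0 := Fin.ext (by simpa using h5)
    have h8 : w 1 = a := Fin.ext (by rw [h7] at h6; simp at h6; exact h6.symm)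
    have h9 : v 2 = b := Fin.ext (by rw [h7] at h12; simpa using h12)
    refine ⟨?_, ?_⟩ <;> funext i <;> fin_cases i
    exacts [h0, h7, h9, h4, h8, h3 ▸ h9]
  rw [Matrix.mul_apply, Finset.sum_eq_single ![a, 0, b], Matrix.mul_apply,
    Finset.sum_eq_single ![a, 0, b], Matrix.mul_apply, Finset.sum_eq_single ![0, a, b]]
  · simp [crossing_zero, crossing_one]
  · intro w _ hw
    by_contra h
    exact hw (hC ![a, 0, b] w rfl (by simp) h).2
  · simp
  · intro v _ hv
    by_contra h
    have h1 := left_ne_zero_of_mul h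
    have h2 := right_ne_zero_of_mul h
    rw [crossing_one] at h1
    have h3 : ![a, 0, b] 0 = v 0 := by by_contra h'; exact h1 (if_neg h')
    rw [if_pos h3] at h1
    have h4 := (rPos_ne_zero h1).2
    rw [Matrix.mul_apply] at h2
    obtain ⟨w, _, hw⟩ := Finset.exists_ne_zero_of_sum_ne_zero h2
    refine hv (hC v w h3.symm ?_ hw).1
    simpa using h4.symm
  · simp
  · intro u _ hu
    by_contra h
    have h1 := left_ne_zero_of_mul h
    rw [crossing_zero] at h1
    have h3 : ![0, a, b] 2 = u 2 := by by_contra h'; exact h1 (if_neg h')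
    rw [if_pos h3] at h1
    obtain ⟨h4, h5⟩ := rNeg_ne_zero h1
    simp at h4 h5
    have h6 : u 0 = a := Fin.ext (by have : (a : ℕ) ≤ u 0 := h4; omega)
    have h7 : u 1 = 0 := Fin.ext (by rw [h6] at h5; simpa using h5)
    refine hu ?_
    funext i; fin_cases i
    exacts [h6, h7, h3.symm]
  · simp

theorem sum_fin_three {N : ℕ} (f : (Fin 3 → Fin N) → K) :
    ∑ x, f x = ∑ i, ∑ j, ∑ k, f ![i, j, k] := by
  let e : Fin N × Fin N × Fin N ≃ (Fin 3 → Fin N) :=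
    { toFun := fun p => ![p.1, p.2.1, p.2.2]
      invFun := fun x => (x 0, x 1, x 2)
      left_inv := fun p => rfl
      right_inv := fun x => by funext i; fin_cases i <;> rfl }
  rw [← e.sum_comp, Fintype.sum_prod_type]
  refine Finset.sum_congr rfl fun i _ => ?_
  rw [Fintype.sum_prod_type]
  rfl

/-- Both inverse crossings occur with m = 0 and give only powers of s. The positive ones occur with
m = b and m = b - a; splitting the first Pochhammer symbol at a produces the square. -/
theorem weight_mul_rMatrix_eq (hs : s ≠ 0) (n : ℕ) (a b : Fin (n + 1)) (hab : (a : ℕ) ≤ b) :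
    s ^ (2 * (2 * ((a : ℕ) : ℤ) - ((n + 1 : ℕ) : ℤ) + 1)) *
      s ^ (2 * (2 * ((b : ℕ) : ℤ) - ((n + 1 : ℕ) : ℤ) + 1)) *
      (rNeg s (n + 1) 0 a a 0 * (rPos s (n + 1) 0 b 0 b *
        (rNeg s (n + 1) a 0 0 a * rPos s (n + 1) a b a b))) =
    ((s ^ 4) ^ n)⁻¹ * (qPoch (s ^ 4) (((s ^ 4) ^ n)⁻¹) a * (s ^ 4) ^ ((a : ℕ) * a + 2 * a : ℕ) *
      gaussBinom (s ^ 4) b (b - a) * qPoch (s ^ 4) (((s ^ 4) ^ n)⁻¹ * (s ^ 4) ^ (a : ℕ)) (b - a) ^ 2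
        * (s ^ 4) ^ (b - a : ℕ)) := by
  have hb := b.is_lt
  obtain ⟨m, hm⟩ : ∃ m : ℕ, (b : ℕ) = a + m := ⟨b - a, by omega⟩
  have hm' : (b : ℕ) - a = m := by omega
  have p1 := prod_bracket_eq_qPoch hs n 0 b (by omega)
  have p2 := prod_bracket_eq_qPoch hs n a m (by omega)
  rw [← hm] at p2
  simp only [zero_add, pow_zero, mul_one] at p1
  simp only [rNeg, rPos, le_refl, hab, true_and, Fin.val_zero, zero_add, add_zero, zero_le,
    if_true, Nat.sub_self, Nat.sub_zero, Finset.range_zero, Finset.prod_empty, Nat.add_sub_cancel,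
    hm', p1, p2, qbinom_eq_gaussBinom hs, gaussBinom_self, gaussBinom_zero_right, pow_zero, one_mul,
    mul_one]
  rw [show qPoch (s ^ 4) (((s ^ 4) ^ n)⁻¹) b = qPoch (s ^ 4) (((s ^ 4) ^ n)⁻¹) a *
    qPoch (s ^ 4) (((s ^ 4) ^ n)⁻¹ * (s ^ 4) ^ (a : ℕ)) m by rw [hm, qPoch_add]]
  generalize qPoch (s ^ 4) (((s ^ 4) ^ n)⁻¹) a = X
  generalize qPoch (s ^ 4) (((s ^ 4) ^ n)⁻¹ * (s ^ 4) ^ (a : ℕ)) m = Y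
  generalize gaussBinom (s ^ 4) b m = Z
  simp only [pow_four_pow, ← zpow_neg]
  -- Once the non-monomial parts are abstracted to X, Y, Z, only an identity between integer
  -- exponents remains.
  have comb : ∀ e1 e2 e3 e4 e5 e6 e7 e8 e9 e10 e11 e12 f1 f2 f3 : ℤ,
      e1 + e2 + e3 + e4 + e5 + e6 + e7 + e8 + e9 + e10 + e11 + e12 = f1 + f2 + f3 →
      s ^ e1 * s ^ e2 * (s ^ e3 * s ^ e4 * (s ^ e5 * (s ^ e6 * (X * Y)) * s ^ e7 *
        (s ^ e8 * s ^ e9 * (s ^ e10 * Z * (s ^ e11 * Y) * s ^ e12)))) =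
      s ^ f1 * (X * s ^ f2 * Z * Y ^ 2 * s ^ f3) := by
    intro e1 e2 e3 e4 e5 e6 e7 e8 e9 e10 e11 e12 f1 f2 f3 h
    have h' := congrArg (s ^ ·) h
    simp only [zpow_add₀ hs] at h'
    linear_combination (X * Y ^ 2 * Z) * h'
  apply comb
  rw [hm]
  push_cast
  ring

theorem ofBraid_figureEightBraid_eq_doubleSum (hs : s ≠ 0) (n : ℕ) :
    ofBraid s (n + 1) 2 figureEightBraid =
    ((s ^ 4) ^ n)⁻¹ * ∑ b ∈ Finset.range (n + 1), ∑ a ∈ Finset.range (b + 1),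
      qPoch (s ^ 4) (((s ^ 4) ^ n)⁻¹) a * (s ^ 4) ^ (a * a + 2 * a) * gaussBinom (s ^ 4) b (b - a) *
        qPoch (s ^ 4) (((s ^ 4) ^ n)⁻¹ * (s ^ 4) ^ a) (b - a) ^ 2 * (s ^ 4) ^ (b - a) := by
  rw [ofBraid, sum_fin_three, Finset.sum_eq_single 0]
  · simp only [Matrix.cons_val_zero, Fin.val_zero, if_true, Fin.prod_univ_two]
    rw [show writhe figureEightBraid = 0 by simp [writhe, figureEightBraid]]
    simp only [zero_mul, neg_zero, zpow_zero, one_mul]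
    rw [Finset.sum_comm, Finset.sum_range, Finset.mul_sum]
    refine Finset.sum_congr rfl fun b _ => ?_
    rw [← Finset.sum_filter_add_sum_filter_not _ (fun a : Fin (n + 1) => (a : ℕ) ≤ b),
      Finset.sum_eq_zero (s := Finset.univ.filter fun a : Fin (n + 1) => ¬ (a : ℕ) ≤ b), add_zero,
      Finset.mul_sum]
    · refine Finset.sum_bij (fun a _ => (a : ℕ)) ?_ ?_ ?_ ?_
      · intro a ha
        have := (Finset.mem_filter.1 ha).2
        exact Finset.mem_range.2 (by omega)
      · intro a _ a' _ h
        exact Fin.ext h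
      · intro a ha
        have h1 := Finset.mem_range.1 ha
        have h2 := b.is_lt
        exact ⟨⟨a, by omega⟩, Finset.mem_filter.2 ⟨Finset.mem_univ _, Nat.lt_succ_iff.1 h1⟩, rfl⟩
      · intro a ha
        rw [braidOperator_figureEightBraid]
        exact weight_mul_rMatrix_eq hs n a b (Finset.mem_filter.1 ha).2
    · intro a ha
      have h : rPos s (n + 1) a b a b = 0 := by
        by_contra h
        exact (Finset.mem_filter.1 ha).2 (rPos_ne_zero h).1
      rw [braidOperator_figureEightBraid, h]
      simp
  · intro i _ hi
    have : (i : ℕ) ≠ 0 := fun h => hi (Fin.ext h)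
    simp [this]
  · simp

/-- The formula of Habiro and Le for the colored Jones polynomial of the figure-eight knot, at a
nonzero `t` that is not a root of unity. -/
theorem figureEight_eq_sum_prod {t : ℂ} (ht : t ≠ 0) (ht1 : ∀ k : ℕ, t ^ (k + 1) ≠ 1) (n : ℕ) :
    figureEight (n + 1) t = ∑ k ∈ Finset.range (n + 1), ∏ j ∈ Finset.range k,
      (t ^ (n + 1) + (t ^ (n + 1))⁻¹ - t ^ (j + 1) - (t ^ (j + 1))⁻¹) := by
  have hs : t ^ (1 / 4 : ℂ) ≠ 0 := by simp [Complex.cpow_eq_zero_iff, ht]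
  have h4 : (t ^ (1 / 4 : ℂ)) ^ 4 = t := by
    rw [one_div]; exact Complex.cpow_nat_inv_pow t (n := 4) (by norm_num)
  rw [figureEight, ofBraid_figureEightBraid_eq_doubleSum hs, h4, doubleSum_eq_sum_prod ht1 ht]

/-- The colored Jones polynomial of the figure-eight knot on the unit circle. -/
theorem figureEight_exp_eq {r : ℝ} (hr : Irrational r) {N : ℕ} (hN : 0 < N) :
    figureEight N (Complex.exp (2 * Real.pi * r * Complex.I / N)) =
      ((∑ k ∈ Finset.range N, ∏ j ∈ Finset.range k, (2 * Real.cos (2 * Real.pi * r) -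
        2 * Real.cos (2 * Real.pi * r / N * (j + 1 : ℕ))) : ℝ) : ℂ) := by
  obtain ⟨n, rfl⟩ : ∃ n, N = n + 1 := ⟨N - 1, by omega⟩
  have hN' : ((n + 1 : ℕ) : ℂ) ≠ 0 := by exact_mod_cast hN.ne'
  have hpow : ∀ m : ℕ, (Complex.exp (2 * Real.pi * r * Complex.I / (n + 1 : ℕ))) ^ m =
      Complex.exp ((2 * Real.pi * r / (n + 1 : ℕ) * m : ℝ) * Complex.I) := by
    intro m
    rw [← Complex.exp_nat_mul]
    congr 1
    push_cast
    ring
  have hcos : ∀ m : ℕ, (Complex.exp (2 * Real.pi * r * Complex.I / (n + 1 : ℕ))) ^ m +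
      ((Complex.exp (2 * Real.pi * r * Complex.I / (n + 1 : ℕ))) ^ m)⁻¹ =
      2 * Real.cos (2 * Real.pi * r / (n + 1 : ℕ) * m) := by
    intro m
    rw [hpow, ← Complex.exp_neg, Complex.ofReal_cos, Complex.two_cos, neg_mul]
  rw [figureEight_eq_sum_prod (Complex.exp_ne_zero _)]
  · push_cast
    refine Finset.sum_congr rfl fun k _ => Finset.prod_congr rfl fun j _ => ?_
    have h1 := hcos (n + 1)
    have h2 := hcos (j + 1)
    rw [div_mul_cancel₀ _ (by exact_mod_cast hN.ne')] at h1
    push_cast at h1 h2 ⊢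
    rw [← h1, ← h2]
    ring
  · intro k hk
    rw [hpow, Complex.exp_eq_one_iff] at hk
    obtain ⟨m, hm⟩ := hk
    have hm' : 2 * Real.pi * r / (n + 1 : ℕ) * (k + 1 : ℕ) = m * (2 * Real.pi) := by
      have h3 : ((2 * Real.pi * r / (n + 1 : ℕ) * (k + 1 : ℕ) : ℝ) : ℂ) =
          ((m * (2 * Real.pi) : ℝ) : ℂ) := by
        refine mul_right_cancel₀ Complex.I_ne_zero ?_
        rw [hm]; push_cast; ring
      exact_mod_cast h3
    -- A root of unity here would make a nonzero integer multiple of r an integer.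
    have h5 : r * (k + 1 : ℕ) = (m * (n + 1 : ℕ) : ℤ) := by
      have := Real.pi_pos
      field_simp at hm'
      push_cast at hm' ⊢
      linarith
    exact (hr.mul_natCast (Nat.succ_ne_zero k)).ne_int _ h5

end StateSum

end ColoredJones

/-! ### The Lobachevsky function and the potential W. -/

section LogTrigonometric

open Real MeasureTheory intervalIntegral

theorem intervalIntegrable_log_abs_two_mul_sin (a b : ℝ) :
    IntervalIntegrable (fun x => log |2 * sin x|) volume a b := by
  have h : MeromorphicOn (fun x : ℝ => 2 * sin x) (Set.uIcc a b) := fun x _ =>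
    AnalyticAt.meromorphicAt (by fun_prop)
  simpa [norm_mul] using h.intervalIntegrable_log_norm

theorem integral_log_abs_two_mul_sin (a b : ℝ) :
    ∫ x in a..b, log |2 * sin x| = lobachevsky a - lobachevsky b := by
  simp only [lobachevsky]
  rw [← integral_add_adjacent_intervals (intervalIntegrable_log_abs_two_mul_sin a 0)
    (intervalIntegrable_log_abs_two_mul_sin 0 b), integral_symm a 0]
  ring

theorem lobachevsky_pi : lobachevsky π = 0 := by
  have h : ∫ x in (0 : ℝ)..π, log |2 * sin x| = ∫ x in (0 : ℝ)..π, (log 2 + log (sin x)) := by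
    refine integral_congr_Ioo_of_le pi_pos.le fun x hx => ?_
    have := sin_pos_of_mem_Ioo hx
    simp only [log_abs]
    rw [log_mul two_ne_zero this.ne']
  have hi : IntervalIntegrable (fun x => log (sin x)) volume 0 π := intervalIntegrable_log_sin
  rw [lobachevsky, h, integral_add intervalIntegrable_const hi,
    integral_log_sin_zero_pi]
  simp
  ring

theorem lobachevsky_add_pi (x : ℝ) : lobachevsky (x + π) = lobachevsky x := by
  have h1 := integral_log_abs_two_mul_sin (0 + π) (x + π)
  have h2 := integral_log_abs_two_mul_sin 0 x
  rw [← integral_comp_add_right (fun x => log |2 * sin x|)] at h1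
  simp only [sin_add_pi, mul_neg, abs_neg] at h1
  rw [zero_add, lobachevsky_pi] at h1
  have h0 : lobachevsky 0 = 0 := by simp [lobachevsky]
  linarith

/-- The logarithm of the modulus of the factors `2 cos ω - 2 cos y`, with `c = cos ω`. -/
noncomputable def logKernel (c y : ℝ) : ℝ := log |2 * c - 2 * cos y|

/-- The primitive of `logKernel c`. -/
noncomputable def logPrimitive (c y : ℝ) : ℝ := ∫ u in (0 : ℝ)..y, logKernel c u

theorem intervalIntegrable_logKernel (c a b : ℝ) :
    IntervalIntegrable (logKernel c) volume a b := by
  have h : MeromorphicOn (fun x : ℝ => 2 * c - 2 * cos x) (Set.uIcc a b) := fun x _ =>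
    AnalyticAt.meromorphicAt (by fun_prop)
  exact h.intervalIntegrable_log_norm

theorem continuous_logPrimitive (c : ℝ) : Continuous (logPrimitive c) :=
  continuous_primitive (intervalIntegrable_logKernel c) 0

theorem logPrimitive_sub (c a b : ℝ) :
    logPrimitive c b - logPrimitive c a = ∫ u in a..b, logKernel c u :=
  integral_interval_sub_left (intervalIntegrable_logKernel c 0 b)
    (intervalIntegrable_logKernel c 0 a)

theorem ae_sin_sub_div_two_ne_zero (w : ℝ) : ∀ᵐ y : ℝ, sin ((w - y) / 2) ≠ 0 := by
  have hc : (Set.range fun n : ℤ => w - 2 * (n * π)).Countable := Set.countable_range _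
  filter_upwards [hc.ae_notMem volume] with y hy h
  obtain ⟨n, hn⟩ := sin_eq_zero_iff.1 h
  exact hy ⟨n, by simp only; linarith⟩

theorem two_mul_cos_sub_two_mul_cos (w y : ℝ) :
    2 * cos w - 2 * cos y = -((2 * sin ((w - y) / 2)) * (2 * sin ((w + y) / 2))) := by
  have := cos_sub_cos w y
  linear_combination 2 * this

theorem ae_two_mul_cos_sub_ne_zero (w : ℝ) : ∀ᵐ y : ℝ, 2 * cos w - 2 * cos y ≠ 0 := by
  filter_upwards [ae_sin_sub_div_two_ne_zero w, ae_sin_sub_div_two_ne_zero (-w)] with y h1 h2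
  rw [two_mul_cos_sub_two_mul_cos]
  have h3 : sin ((w + y) / 2) ≠ 0 := by
    rw [show (w + y) / 2 = -((-w - y) / 2) by ring, sin_neg]
    exact neg_ne_zero.2 h2
  simp [h1, h3]

/-- The difference of cosines is, up to sign, a product of two sines at half angles, and the
logarithm of each integrates to a Lobachevsky function. Splitting the logarithm is valid off a
countable set. -/
theorem logPrimitive_cos (w y : ℝ) :
    logPrimitive (cos w) y = 2 * lobachevsky ((w - y) / 2) - 2 * lobachevsky ((w + y) / 2) := by
  have i1 : ∫ u in (0 : ℝ)..y, log |2 * sin ((w - u) / 2)| =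
      2 * (lobachevsky ((w - y) / 2) - lobachevsky (w / 2)) := by
    have := integral_comp_sub_div (a := 0) (b := y) (fun x => log |2 * sin x|)
      (two_ne_zero) (w / 2)
    simp only [← sub_div, sub_zero, zero_div] at this
    rw [this, integral_log_abs_two_mul_sin, smul_eq_mul]
  have i2 : ∫ u in (0 : ℝ)..y, log |2 * sin ((w + u) / 2)| =
      2 * (lobachevsky (w / 2) - lobachevsky ((w + y) / 2)) := by
    have := integral_comp_add_div (a := 0) (b := y) (fun x => log |2 * sin x|)
      (two_ne_zero) (w / 2)
    simp only [← add_div, add_zero, zero_div] at this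
    rw [this, integral_log_abs_two_mul_sin, smul_eq_mul]
  have m : ∀ ε : ℝ, IntervalIntegrable (fun u => log |2 * sin ((w + ε * u) / 2)|) volume 0 y := by
    intro ε
    have h : MeromorphicOn (fun u : ℝ => 2 * sin ((w + ε * u) / 2)) (Set.uIcc 0 y) := fun x _ =>
      AnalyticAt.meromorphicAt (by fun_prop)
    simpa [norm_mul] using h.intervalIntegrable_log_norm
  have m1 := m (-1)
  have m2 := m 1
  simp only [neg_mul, one_mul, ← sub_eq_add_neg] at m1 m2
  have key : logPrimitive (cos w) y =
      ∫ u in (0 : ℝ)..y, (log |2 * sin ((w - u) / 2)| + log |2 * sin ((w + u) / 2)|) := by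
    refine integral_congr_ae ?_
    filter_upwards [ae_sin_sub_div_two_ne_zero w, ae_sin_sub_div_two_ne_zero (-w)] with u h1 h2 _
    have h3 : sin ((w + u) / 2) ≠ 0 := by
      rw [show (w + u) / 2 = -((-w - u) / 2) by ring, sin_neg]
      exact neg_ne_zero.2 h2
    rw [logKernel, two_mul_cos_sub_two_mul_cos, abs_neg, abs_mul, log_mul] <;> simp [h1, h3]
  rw [key, integral_add m1 m2, i1, i2]
  ring

theorem logPrimitive_cos_pi (w : ℝ) : logPrimitive (cos w) π = 0 := by
  rw [logPrimitive_cos, show (w + π) / 2 = (w - π) / 2 + π by ring, lobachevsky_add_pi, sub_self]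

/-- A consequence of the π-periodicity of Λ. It turns the minimum of W at θ into the maximum at 2π -
θ. -/
theorem logPrimitive_cos_two_pi_sub (w y : ℝ) :
    logPrimitive (cos w) (2 * π - y) = -logPrimitive (cos w) y := by
  rw [logPrimitive_cos, logPrimitive_cos, show (w + (2 * π - y)) / 2 = (w - y) / 2 + π by ring,
    lobachevsky_add_pi, ← lobachevsky_add_pi ((w - (2 * π - y)) / 2),
    show (w - (2 * π - y)) / 2 + π = (w + y) / 2 by ring]
  ring

theorem logPrimitive_cos_add_two_pi (w y : ℝ) :
    logPrimitive (cos w) (y + 2 * π) = logPrimitive (cos w) y := by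
  rw [logPrimitive_cos, logPrimitive_cos, show (w + (y + 2 * π)) / 2 = (w + y) / 2 + π by ring,
    lobachevsky_add_pi, ← lobachevsky_add_pi ((w - (y + 2 * π)) / 2),
    show (w - (y + 2 * π)) / 2 + π = (w - y) / 2 by ring]

end LogTrigonometric

/-! ### The maximum of the potential. -/

section PotentialBounds

open Real MeasureTheory intervalIntegral

variable {c : ℝ}

theorem logPrimitive_le_of_one_le {a b : ℝ} (hab : a ≤ b)
    (h : ∀ u ∈ Set.Icc a b, 1 ≤ |2 * c - 2 * cos u|) : logPrimitive c a ≤ logPrimitive c b := by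
  rw [← sub_nonneg, logPrimitive_sub]
  exact integral_nonneg hab fun u hu => log_nonneg (h u hu)

theorem logPrimitive_le_of_le_one {a b : ℝ} (hab : a ≤ b)
    (h : ∀ u ∈ Set.Icc a b, |2 * c - 2 * cos u| ≤ 1) : logPrimitive c b ≤ logPrimitive c a := by
  rw [← sub_nonpos, logPrimitive_sub, ← neg_nonneg, ← intervalIntegral.integral_neg]
  exact integral_nonneg hab fun u hu => neg_nonneg.2 (log_nonpos (abs_nonneg _) (h u hu))

theorem le_cos_of_le_arccos {x y : ℝ} (hx : -1 ≤ x) (hx1 : x ≤ 1) (hy : 0 ≤ y)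
    (h : y ≤ arccos x) : x ≤ cos y := by
  rw [← cos_arccos hx hx1]
  exact cos_le_cos_of_nonneg_of_le_pi hy (arccos_le_pi _) h

theorem cos_le_of_arccos_le {x y : ℝ} (hx : -1 ≤ x) (hx1 : x ≤ 1) (hy : y ≤ π)
    (h : arccos x ≤ y) : cos y ≤ x := by
  rw [← cos_arccos hx hx1]
  exact cos_le_cos_of_nonneg_of_le_pi (arccos_nonneg _) hy h

/-- Strictly between the two points the kernel argument lies in (0, 1), so W decreases. After
reflection this separates the maximum from the endpoint 2π - φ. -/
theorem logPrimitive_arccos_lt (hc : 0 < c) (hc1 : c < 1 / 2) :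
    logPrimitive c (arccos (c - 1 / 2)) < logPrimitive c (arccos c) := by
  have h1 : arccos c < arccos (c - 1 / 2) :=
    strictAntiOn_arccos ⟨by linarith, by linarith⟩ ⟨by linarith, by linarith⟩ (by linarith)
  rw [← sub_neg, logPrimitive_sub, ← neg_pos, ← intervalIntegral.integral_neg]
  refine intervalIntegral_pos_of_pos_on (intervalIntegrable_logKernel c _ _).neg ?_ h1
  intro x hx
  have h0 : 0 ≤ arccos c := arccos_nonneg c
  have hpi : arccos (c - 1 / 2) ≤ π := arccos_le_pi _
  have h2 : cos x < c := by
    conv_rhs => rw [← cos_arccos (show -1 ≤ c by linarith) (by linarith)]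
    exact cos_lt_cos_of_nonneg_of_le_pi h0 (by linarith [hx.2]) hx.1
  have h3 : c - 1 / 2 < cos x := by
    conv_lhs => rw [← cos_arccos (show -1 ≤ c - 1 / 2 by linarith) (by linarith)]
    exact cos_lt_cos_of_nonneg_of_le_pi (by linarith [hx.1]) hpi hx.2
  refine neg_pos.2 (log_neg (abs_pos.2 (by linarith)) ?_)
  rw [abs_of_pos (by linarith)]
  linarith

/-- The competing local maximum of W is at t, where the factor is -1. Since W(π) = 0, the right side
is the integral over [θ, π], reflected to [0, π - θ]. There 2c + 2 cos u exceeds 2 cos u - 2c on [0,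
t] because c > 0, and the rest contributes a nonnegative amount. The hypothesis c < 1/2 makes t
positive, hence the inequality strict. -/
theorem logPrimitive_arccos_add_half_lt (hc : 0 < c) (hc1 : c < 1 / 2)
    (hpi : logPrimitive c π = 0) :
    logPrimitive c (arccos (c + 1 / 2)) < -logPrimitive c (arccos (c - 1 / 2)) := by
  set t := arccos (c + 1 / 2) with ht
  set θ := arccos (c - 1 / 2) with hθ
  have hpos : 0 < t := arccos_pos.2 (by linarith)
  have e1 : π - θ = arccos (1 / 2 - c) := by
    rw [hθ, ← arccos_neg]; congr 1; ring
  have htθ : t ≤ π - θ := by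
    rw [e1]
    exact strictAntiOn_arccos.antitoneOn ⟨by linarith, by linarith⟩ ⟨by linarith, by linarith⟩
      (by linarith)
  have e2 : -logPrimitive c θ = ∫ u in (0 : ℝ)..(π - θ), logKernel c (π - u) := by
    rw [integral_comp_sub_left (logKernel c) π]
    simp only [sub_sub_cancel, sub_zero]
    rw [← logPrimitive_sub, hpi, zero_sub]
  have hint : ∀ a b : ℝ, IntervalIntegrable (fun u => logKernel c (π - u)) volume a b := by
    intro a b
    have := (intervalIntegrable_logKernel c (π - a) (π - b)).comp_sub_left π
    simpa using this
  have h1 : ∫ u in (0 : ℝ)..t, logKernel c (π - u) ≤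
      ∫ u in (0 : ℝ)..(π - θ), logKernel c (π - u) := by
    rw [← sub_nonneg, integral_interval_sub_left (hint _ _) (hint _ _)]
    refine integral_nonneg htθ fun u hu => log_nonneg ?_
    have h2 : 1 / 2 - c ≤ cos u := le_cos_of_le_arccos (by linarith) (by linarith)
      (by linarith [hu.1]) (by rw [← e1]; exact hu.2)
    rw [cos_pi_sub, abs_of_pos (by linarith)]
    linarith
  rw [e2]
  refine lt_of_lt_of_le ?_ h1
  have hcos : ∀ u ∈ Set.Icc 0 t, c + 1 / 2 ≤ cos u := fun u hu =>
    le_cos_of_le_arccos (by linarith) (by linarith) hu.1 hu.2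
  rw [← sub_pos, logPrimitive,
    ← intervalIntegral.integral_sub (hint _ _) (intervalIntegrable_logKernel c _ _)]
  refine intervalIntegral_pos_of_pos_on ((hint _ _).sub (intervalIntegrable_logKernel c _ _)) ?_ hpos
  intro u hu
  have h3 := hcos u ⟨hu.1.le, hu.2.le⟩
  rw [sub_pos, logKernel, logKernel, cos_pi_sub, abs_of_neg (show 2 * c - 2 * cos u < 0 by linarith),
    abs_of_pos (show 0 < 2 * c - 2 * -cos u by linarith)]
  exact log_lt_log (by linarith) (by linarith)

/-- The primitive of the kernel attains its maximum `P` over `[0, 5π/2]` at `2π - θ`, and stays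
away from it outside the interval where the kernel has positive argument. -/
theorem exists_logPrimitive_bounds {w : ℝ} (hc : 0 < cos w) (hc1 : cos w < 1 / 2) :
    ∃ V, 0 ≤ V ∧ V < -logPrimitive (cos w) (arccos (cos w - 1 / 2)) ∧
      (∀ y, 0 ≤ y → y ≤ 5 * π / 2 →
        logPrimitive (cos w) y ≤ -logPrimitive (cos w) (arccos (cos w - 1 / 2))) ∧
      ∀ y, 0 ≤ y → y ≤ 5 * π / 2 → (y < arccos (cos w) ∨ 2 * π - arccos (cos w) < y) →
        logPrimitive (cos w) y ≤ V := by
  have hpi := logPrimitive_cos_pi w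
  have hrefl := logPrimitive_cos_two_pi_sub w
  have hper := logPrimitive_cos_add_two_pi w
  set c := cos w
  set t := arccos (c + 1 / 2) with ht
  set θ := arccos (c - 1 / 2) with hθ
  set φ := arccos c with hφ
  have hlt1 := logPrimitive_arccos_add_half_lt hc hc1 hpi
  have hlt2 := logPrimitive_arccos_lt hc hc1
  have hanti := strictAntiOn_arccos.antitoneOn
  have htφ : t ≤ φ := hanti ⟨by linarith, by linarith⟩ ⟨by linarith, by linarith⟩ (by linarith)
  have hφθ : φ ≤ θ := hanti ⟨by linarith, by linarith⟩ ⟨by linarith, by linarith⟩ (by linarith)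
  have ht0 : 0 ≤ t := arccos_nonneg _
  have hθpi : θ ≤ π := arccos_le_pi _
  have hφpi : φ ≤ π / 2 := arccos_le_pi_div_two.2 hc.le
  have hW0 : logPrimitive c 0 = 0 := by simp [logPrimitive]
  -- On [0, π] the potential rises up to t, falls up to θ and rises again; reflection and
  -- periodicity carry this to [0, 5π/2].
  have m1 : ∀ a b, 0 ≤ a → a ≤ b → b ≤ t → logPrimitive c a ≤ logPrimitive c b := by
    intro a b ha hab hb
    refine logPrimitive_le_of_one_le hab fun u hu => ?_
    have := le_cos_of_le_arccos (show -1 ≤ c + 1 / 2 by linarith) (by linarith)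
      (ha.trans hu.1) (hu.2.trans hb)
    rw [abs_of_neg (by linarith)]; linarith
  have m2 : ∀ a b, t ≤ a → a ≤ b → b ≤ θ → logPrimitive c b ≤ logPrimitive c a := by
    intro a b ha hab hb
    refine logPrimitive_le_of_le_one hab fun u hu => ?_
    have h1 := cos_le_of_arccos_le (show -1 ≤ c + 1 / 2 by linarith) (by linarith)
      (hu.2.trans (hb.trans hθpi)) (ha.trans hu.1)
    have h2 := le_cos_of_le_arccos (show -1 ≤ c - 1 / 2 by linarith) (by linarith)
      (ht0.trans (ha.trans hu.1)) (hu.2.trans hb)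
    rw [abs_le]; constructor <;> linarith
  have m3 : ∀ a b, θ ≤ a → a ≤ b → b ≤ π → logPrimitive c a ≤ logPrimitive c b := by
    intro a b ha hab hb
    refine logPrimitive_le_of_one_le hab fun u hu => ?_
    have := cos_le_of_arccos_le (show -1 ≤ c - 1 / 2 by linarith) (by linarith)
      (hu.2.trans hb) (ha.trans hu.1)
    rw [abs_of_pos (by linarith)]; linarith
  have hV0 : 0 ≤ logPrimitive c t := hW0 ▸ m1 0 t le_rfl ht0 le_rfl
  have up : ∀ y, 0 ≤ y → y ≤ π → logPrimitive c y ≤ logPrimitive c t := by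
    intro y hy hy1
    rcases le_total y t with h | h
    · exact m1 y t hy h le_rfl
    rcases le_total y θ with h' | h'
    · exact m2 t y le_rfl h h'
    · exact ((m3 y π h' hy1 le_rfl).trans hpi.le).trans hV0
  have lo : ∀ y, 0 ≤ y → y ≤ π → logPrimitive c θ ≤ logPrimitive c y := by
    intro y hy hy1
    rcases le_total y t with h | h
    · have := m1 0 y le_rfl hy h
      linarith
    rcases le_total y θ with h' | h'
    · exact m2 y θ h h' le_rfl
    · exact m3 θ y le_rfl h' hy1
  have lo' : ∀ y, 0 ≤ y → y ≤ φ → min 0 (logPrimitive c φ) ≤ logPrimitive c y := by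
    intro y hy hy1
    rcases le_total y t with h | h
    · exact (min_le_left _ _).trans (hW0 ▸ m1 0 y le_rfl hy h)
    · exact (min_le_right _ _).trans (m2 y φ h hy1 hφθ)
  -- The two candidates outside [φ, 2π - φ]: the local maximum at t, and the value -W(φ) = W(2π - φ)
  -- at the right edge.
  refine ⟨max (logPrimitive c t) (-logPrimitive c φ), le_max_of_le_left hV0,
    max_lt hlt1 (neg_lt_neg hlt2), ?_, ?_⟩
  · intro y hy hy1
    rcases le_total y π with h | h
    · exact (up y hy h).trans hlt1.le
    rcases le_total y (2 * π) with h' | h'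
    · have h3 := hrefl y
      have h4 := lo (2 * π - y) (by linarith) (by linarith)
      linarith
    · have h3 := hper (y - 2 * π)
      rw [sub_add_cancel] at h3
      have h4 := up (y - 2 * π) (by linarith) (by linarith)
      linarith
  · intro y hy hy1 hy2
    rcases hy2 with h | h
    · exact le_max_of_le_left (up y hy (by linarith))
    rcases le_total y (2 * π) with h' | h'
    · have h3 := hrefl y
      have h4 := lo' (2 * π - y) (by linarith) (by linarith)
      rcases min_le_iff.1 h4 with h5 | h5
      · exact le_max_of_le_left (by linarith)
      · exact le_max_of_le_right (by linarith)
    · have h3 := hper (y - 2 * π)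
      rw [sub_add_cancel] at h3
      have h4 := up (y - 2 * π) (by linarith) (by linarith)
      exact le_max_of_le_left (by linarith)

end PotentialBounds

/-! ### Riemann sums for a kernel with logarithmic singularities. -/

section RiemannSums

open Real MeasureTheory intervalIntegral Filter Topology

theorem abs_sum_sub_integral_le {f : ℝ → ℝ} {K η : ℝ} (hη : 0 ≤ η)
    (hf : ∀ x y, |f x - f y| ≤ K * |x - y|) (hc : Continuous f) (k : ℕ) :
    |∑ j ∈ Finset.range k, η * f (η * (j + 1 : ℕ)) - ∫ x in (0 : ℝ)..η * k, f x| ≤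
      K * η ^ 2 * k := by
  have hK : 0 ≤ K := by
    have := (abs_nonneg _).trans (hf 1 0)
    simpa using this
  induction k with
  | zero => simp
  | succ k ih =>
    rw [Finset.sum_range_succ, ← integral_add_adjacent_intervals
      (hc.intervalIntegrable 0 (η * k)) (hc.intervalIntegrable (η * k) (η * (k + 1 : ℕ)))]
    have hle : η * k ≤ η * (k + 1 : ℕ) := by push_cast; nlinarith
    have h1 : |η * f (η * (k + 1 : ℕ)) - ∫ x in η * k..η * (k + 1 : ℕ), f x| ≤ K * η ^ 2 := by
      have e : η * f (η * (k + 1 : ℕ)) - ∫ x in η * k..η * (k + 1 : ℕ), f x =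
          ∫ x in η * k..η * (k + 1 : ℕ), (f (η * (k + 1 : ℕ)) - f x) := by
        rw [integral_sub intervalIntegrable_const (hc.intervalIntegrable _ _),
          intervalIntegral.integral_const,
          smul_eq_mul]
        push_cast; ring
      rw [e]
      have := norm_integral_le_of_norm_le_const (a := η * k) (b := η * (k + 1 : ℕ)) (C := K * η)
        (f := fun x => f (η * (k + 1 : ℕ)) - f x) (fun x hx => by
          rw [Set.uIoc_of_le hle] at hx
          refine (hf _ _).trans (mul_le_mul_of_nonneg_left ?_ hK)
          rw [abs_of_nonneg (by linarith [hx.2])]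
          have := hx.1
          push_cast; linarith)
      refine this.trans (le_of_eq ?_)
      rw [abs_of_nonneg (by linarith)]
      push_cast; ring
    rw [show ∀ a b c d : ℝ, a + b - (c + d) = (a - c) + (b - d) by intros; ring]
    refine (abs_add_le _ _).trans ((add_le_add ih h1).trans (le_of_eq ?_))
    push_cast; ring

/-- The kernel `log |2c - 2 cos y|`, cut off below at `log δ`. -/
noncomputable def truncKernel (c δ y : ℝ) : ℝ := log (max |2 * c - 2 * cos y| δ)

theorem continuous_truncKernel {c δ : ℝ} (hδ : 0 < δ) : Continuous (truncKernel c δ) :=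
  Continuous.log (by fun_prop) fun _ => (lt_max_of_lt_right hδ).ne'

theorem abs_truncKernel_sub_le {c δ : ℝ} (hδ : 0 < δ) (x y : ℝ) :
    |truncKernel c δ x - truncKernel c δ y| ≤ 2 / δ * |x - y| := by
  have key : ∀ x y, truncKernel c δ x - truncKernel c δ y ≤ 2 / δ * |x - y| := by
    intro x y
    have hx : 0 < max |2 * c - 2 * cos x| δ := lt_max_of_lt_right hδ
    have hy : 0 < max |2 * c - 2 * cos y| δ := lt_max_of_lt_right hδ
    have h1 : max |2 * c - 2 * cos x| δ - max |2 * c - 2 * cos y| δ ≤ 2 * |x - y| := by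
      refine (le_abs_self _).trans ((abs_max_sub_max_le_abs _ _ _).trans
        ((abs_abs_sub_abs_le_abs_sub _ _).trans ?_))
      rw [show 2 * c - 2 * cos x - (2 * c - 2 * cos y) = -(2 * (cos x - cos y)) by ring, abs_neg,
        abs_mul, abs_two]
      exact mul_le_mul_of_nonneg_left (abs_cos_sub_cos_le x y) zero_le_two
    rw [truncKernel, truncKernel, ← log_div hx.ne' hy.ne']
    refine (log_le_sub_one_of_pos (div_pos hx hy)).trans ?_
    rw [div_sub_one hy.ne', div_mul_eq_mul_div]
    exact div_le_div₀ (by positivity) h1 hδ (le_max_right _ _)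
  rw [abs_le]
  constructor
  · have := key y x
    rw [abs_sub_comm] at this
    linarith
  · exact key x y

theorem ae_logKernel_le_truncKernel (w δ : ℝ) :
    ∀ᵐ y : ℝ, logKernel (cos w) y ≤ truncKernel (cos w) δ y := by
  filter_upwards [ae_two_mul_cos_sub_ne_zero w] with y hy
  exact log_le_log (abs_pos.2 hy) (le_max_left _ _)

theorem logPrimitive_le_integral_truncKernel {w δ y : ℝ} (hδ : 0 < δ) (hy : 0 ≤ y) :
    logPrimitive (cos w) y ≤ ∫ u in (0 : ℝ)..y, truncKernel (cos w) δ u :=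
  integral_mono_ae hy (intervalIntegrable_logKernel _ _ _)
    ((continuous_truncKernel hδ).intervalIntegrable _ _) (ae_logKernel_le_truncKernel w δ)

/-- Dominated convergence is needed only on [0, L]. The truncated kernel dominates the original
almost everywhere, so the excess grows with y and one cutoff serves all y. -/
theorem exists_integral_truncKernel_le (w L : ℝ) {ε : ℝ} (hε : 0 < ε) :
    ∃ δ₀, 0 < δ₀ ∧ ∀ y, 0 ≤ y → y ≤ L →
      ∫ u in (0 : ℝ)..y, truncKernel (cos w) δ₀ u ≤ logPrimitive (cos w) y + ε := by
  have hlim : Tendsto (fun n : ℕ => ∫ u in (0 : ℝ)..L, truncKernel (cos w) (1 / ((n : ℝ) + 1)) u)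
      atTop (𝓝 (∫ u in (0 : ℝ)..L, logKernel (cos w) u)) := by
    refine intervalIntegral.tendsto_integral_filter_of_dominated_convergence
      (fun u => |logKernel (cos w) u| + log 4) ?_ ?_ ?_ ?_
    · exact Eventually.of_forall fun n =>
        (continuous_truncKernel (Nat.one_div_pos_of_nat)).aestronglyMeasurable
    · refine Eventually.of_forall fun n => ?_
      filter_upwards [ae_two_mul_cos_sub_ne_zero w] with y hy _
      have h0 : 0 < |2 * cos w - 2 * cos y| := abs_pos.2 hy
      have h1 : (1 : ℝ) / (n + 1) ≤ 1 := by
        rw [div_le_one (by positivity)]; linarith [(Nat.cast_nonneg n : (0 : ℝ) ≤ n)]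
      have h2 : |2 * cos w - 2 * cos y| ≤ 4 := by
        rw [abs_le]; constructor <;>
          linarith [neg_one_le_cos w, neg_one_le_cos y, cos_le_one w, cos_le_one y]
      have h3 : truncKernel (cos w) (1 / ((n : ℝ) + 1)) y ≤ log 4 :=
        log_le_log (lt_max_of_lt_left h0) (max_le h2 (h1.trans (by norm_num)))
      have h4 : logKernel (cos w) y ≤ truncKernel (cos w) (1 / ((n : ℝ) + 1)) y :=
        log_le_log h0 (le_max_left _ _)
      have h5 : 0 ≤ log 4 := log_nonneg (by norm_num)
      rw [norm_eq_abs, abs_le]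
      constructor
      · linarith [neg_abs_le (logKernel (cos w) y)]
      · linarith [abs_nonneg (logKernel (cos w) y)]
    · exact (intervalIntegrable_logKernel _ _ _).abs.add intervalIntegrable_const
    · filter_upwards [ae_two_mul_cos_sub_ne_zero w] with y hy _
      have h0 : 0 < |2 * cos w - 2 * cos y| := abs_pos.2 hy
      refine tendsto_const_nhds.congr' ?_
      filter_upwards [tendsto_one_div_add_atTop_nhds_zero_nat.eventually (gt_mem_nhds h0)] with n hn
      rw [truncKernel, max_eq_left hn.le, logKernel]
  obtain ⟨n, hn⟩ := (hlim.eventually (gt_mem_nhds (lt_add_of_pos_right _ hε))).exists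
  have hδ : (0 : ℝ) < 1 / ((n : ℝ) + 1) := Nat.one_div_pos_of_nat
  refine ⟨1 / ((n : ℝ) + 1), hδ, fun y hy hyL => ?_⟩
  have i1 := (continuous_truncKernel (c := cos w) hδ).intervalIntegrable (μ := volume)
  have i2 := intervalIntegrable_logKernel (cos w)
  have h1 := integral_add_adjacent_intervals (i1 0 y) (i1 y L)
  have h2 := integral_add_adjacent_intervals (i2 0 y) (i2 y L)
  have h3 := integral_mono_ae hyL (i2 y L) (i1 y L) (ae_logKernel_le_truncKernel w _)
  rw [logPrimitive]
  linarith

/-- Uniform upper bound for the partial products. -/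
theorem exists_prod_le_exp (w : ℝ) (hw : 0 < w) {ε : ℝ} (hε : 0 < ε) :
    ∃ C : ℝ, ∀ N : ℕ, 0 < N → ∀ k ≤ N,
      ∏ j ∈ Finset.range k, |2 * cos w - 2 * cos (w / N * (j + 1 : ℕ))| ≤
        exp (N / w * (logPrimitive (cos w) (w / N * k) + ε) + C) := by
  obtain ⟨δ, hδ, hδ'⟩ := exists_integral_truncKernel_le w w hε
  refine ⟨2 / δ * w, fun N hN k hk => ?_⟩
  have hN' : (0 : ℝ) < N := by exact_mod_cast hN
  have hη : 0 < w / N := by positivity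
  have hkN : (k : ℝ) ≤ N := by exact_mod_cast hk
  have hηk : w / N * k ≤ w := by
    rw [div_mul_eq_mul_div, div_le_iff₀ hN']
    exact mul_le_mul_of_nonneg_left hkN hw.le
  have h1 : ∏ j ∈ Finset.range k, |2 * cos w - 2 * cos (w / N * (j + 1 : ℕ))| ≤
      exp (∑ j ∈ Finset.range k, truncKernel (cos w) δ (w / N * (j + 1 : ℕ))) := by
    rw [exp_sum]
    refine Finset.prod_le_prod (fun _ _ => abs_nonneg _) fun j _ => ?_
    rw [truncKernel, exp_log (lt_max_of_lt_right hδ)]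
    exact le_max_left _ _
  refine h1.trans (exp_le_exp.2 ?_)
  have h2 := (abs_le.1 (abs_sum_sub_integral_le hη.le (abs_truncKernel_sub_le (c := cos w) hδ)
    (continuous_truncKernel hδ) k)).2
  have h3 := hδ' (w / N * k) (by positivity) hηk
  rw [← Finset.mul_sum] at h2
  have h4 : 2 / δ * (w / N) ^ 2 * k ≤ 2 / δ * w * (w / N) := by
    calc 2 / δ * (w / N) ^ 2 * k = 2 / δ * (w / N) * (w / N * k) := by ring
      _ ≤ 2 / δ * (w / N) * w := mul_le_mul_of_nonneg_left hηk (by positivity)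
      _ = _ := by ring
  have h5 : w / N * ∑ j ∈ Finset.range k, truncKernel (cos w) δ (w / N * (j + 1 : ℕ)) ≤
      w / N * (N / w * (logPrimitive (cos w) (w / N * k) + ε) + 2 / δ * w) := by
    have e : w / N * (N / w * (logPrimitive (cos w) (w / N * k) + ε) + 2 / δ * w) =
      logPrimitive (cos w) (w / N * k) + ε + 2 / δ * w * (w / N) := by
      field_simp
    rw [e]; linarith
  exact le_of_mul_le_mul_left h5 hη

/-- Factors with index beyond D equal 1. Up to there the product is D^m / m!, a single term of the
exponential series. -/
theorem prod_max_one_div_le_exp {D : ℝ} (hD : 0 ≤ D) (m : ℕ) :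
    ∏ i ∈ Finset.range m, max 1 (D / (i + 1 : ℕ)) ≤ exp D := by
  induction m with
  | zero => simpa using hD
  | succ m ih =>
    rcases le_total D (m + 1 : ℕ) with h | h
    · rw [Finset.prod_range_succ, max_eq_left ((div_le_one (by positivity)).2 h), mul_one]
      exact ih
    · have e : ∏ i ∈ Finset.range (m + 1), max 1 (D / (i + 1 : ℕ)) =
          D ^ (m + 1) / (m + 1).factorial := by
        have e1 : ∀ i ∈ Finset.range (m + 1), max 1 (D / (i + 1 : ℕ)) = D / (i + 1 : ℕ) := by
          intro i hi
          refine max_eq_right ((one_le_div (by positivity)).2 (le_trans ?_ h))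
          exact_mod_cast Finset.mem_range.1 hi
        rw [Finset.prod_congr rfl e1, Finset.prod_div_distrib, Finset.prod_const,
          Finset.card_range, ← Finset.prod_range_add_one_eq_factorial]
        push_cast; rfl
      rw [e]
      exact pow_div_factorial_le_exp D hD (m + 1)

theorem sum_log_max_one_div_le {D : ℝ} (hD : 0 ≤ D) (m : ℕ) :
    ∑ i ∈ Finset.range m, log (max 1 (D / (i + 1 : ℕ))) ≤ D := by
  rw [← log_prod fun i _ => (lt_max_of_lt_left one_pos).ne',
    log_le_iff_le_exp (Finset.prod_pos fun i _ => lt_max_of_lt_left one_pos)]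
  exact prod_max_one_div_le_exp hD m

/-- The total logarithmic loss from the proximity of integers to a point `x`. -/
theorem sum_log_max_one_div_abs_sub_le {D κ x : ℝ} (hD : 0 ≤ D) (hκ : 0 < κ) (hκ1 : κ ≤ 1)
    (hx : ∀ j : ℕ, κ ≤ |(j : ℝ) - x|) (m : ℕ) :
    ∑ j ∈ Finset.range m, log (max 1 (D * κ / |(j : ℝ) - x|)) ≤ 2 * D := by
  set a := ⌈x⌉₊ with ha
  have hnn : ∀ y : ℝ, 0 ≤ log (max 1 y) := fun y => log_nonneg (le_max_left _ _)
  -- On either side of x the i-th integer is at distance at least κ + i ≥ κ (i + 1), because κ ≤ 1.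
  have hterm : ∀ (i : ℕ) (y : ℝ), κ + i ≤ y →
      log (max 1 (D * κ / y)) ≤ log (max 1 (D / (i + 1 : ℕ))) := by
    intro i y hy
    refine log_le_log (lt_max_of_lt_left one_pos) (max_le_max le_rfl ?_)
    have hi : (0 : ℝ) ≤ i := Nat.cast_nonneg i
    rw [div_le_div_iff₀ (by linarith) (by positivity), mul_assoc]
    refine mul_le_mul_of_nonneg_left ?_ hD
    push_cast
    nlinarith
  have hax : x ≤ a := Nat.le_ceil x
  calc ∑ j ∈ Finset.range m, log (max 1 (D * κ / |(j : ℝ) - x|))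
      ≤ ∑ j ∈ Finset.range (a + m), log (max 1 (D * κ / |(j : ℝ) - x|)) :=
        Finset.sum_le_sum_of_subset_of_nonneg (Finset.range_mono (by omega)) fun _ _ _ => hnn _
    _ = ∑ i ∈ Finset.range a, log (max 1 (D * κ / |((a - 1 - i : ℕ) : ℝ) - x|)) +
        ∑ i ∈ Finset.range m, log (max 1 (D * κ / |((a + i : ℕ) : ℝ) - x|)) := by
        rw [Finset.sum_range_add, Finset.sum_range_reflect
          (fun j => log (max 1 (D * κ / |(j : ℝ) - x|)))]
    _ ≤ ∑ i ∈ Finset.range a, log (max 1 (D / (i + 1 : ℕ))) +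
        ∑ i ∈ Finset.range m, log (max 1 (D / (i + 1 : ℕ))) := by
        refine add_le_add (Finset.sum_le_sum fun i hi => hterm i _ ?_)
          (Finset.sum_le_sum fun i _ => hterm i _ ?_)
        · have hi' := Finset.mem_range.1 hi
          have h1 : ((a - 1 : ℕ) : ℝ) < x := Nat.lt_ceil.1 (by omega)
          have h2 := hx (a - 1)
          rw [abs_of_neg (by linarith)] at h2
          have h3 : ((a - 1 - i : ℕ) : ℝ) = ((a - 1 : ℕ) : ℝ) - i := by
            rw [Nat.cast_sub (by omega)]
          have hi0 : (0 : ℝ) ≤ i := Nat.cast_nonneg i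
          rw [h3, abs_of_neg (by linarith)]
          linarith
        · have h2 := hx a
          rw [abs_of_nonneg (by linarith)] at h2
          have hi0 : (0 : ℝ) ≤ i := Nat.cast_nonneg i
          push_cast
          rw [abs_of_nonneg (by linarith)]
          linarith
    _ ≤ 2 * D := by
        linarith [sum_log_max_one_div_le hD a, sum_log_max_one_div_le hD m]

/-- Lower bound for the partial products, for those `N` for which the zero `φ` of the kernel
is not close to a sampling point. -/
theorem exists_exp_le_prod (w : ℝ) (hw : 0 < w) {φ c₀ B κ : ℝ} (hc₀ : 0 < c₀)
    (hκ : 0 < κ) (hκ1 : κ ≤ 1) (hBw : B ≤ w)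
    (hB : ∀ y, 0 ≤ y → y ≤ B → c₀ * |y - φ| ≤ |2 * cos w - 2 * cos y|) {ε : ℝ} (hε : 0 < ε) :
    ∃ C : ℝ, ∀ N : ℕ, 0 < N → (∀ j : ℕ, κ ≤ |(j : ℝ) - N * (φ / w)|) → ∀ k : ℕ, w / N * k ≤ B →
      exp (N / w * (logPrimitive (cos w) (w / N * k) - ε) - C) ≤
        ∏ j ∈ Finset.range k, |2 * cos w - 2 * cos (w / N * (j + 1 : ℕ))| := by
  -- Chosen so that (w/N) c₀ · D κ = δ with D = (N/w)(ε/2). Each truncated factor then exceeds the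
  -- true one by at most max(1, Dκ/distance), and the total loss 2D is exactly (N/w) ε.
  set δ : ℝ := ε * c₀ * κ / 2 with hδd
  have hδ : 0 < δ := by positivity
  refine ⟨2 / δ * w, fun N hN hgood k hk => ?_⟩
  have hN' : (0 : ℝ) < N := by exact_mod_cast hN
  have hη : 0 < w / N := by positivity
  have hηk : w / N * k ≤ w := hk.trans hBw
  set D : ℝ := N / w * (ε / 2) with hD
  have hD0 : 0 ≤ D := by positivity
  have hdist : ∀ j ∈ Finset.range k, w / N * c₀ * |((j + 1 : ℕ) : ℝ) - N * (φ / w)| ≤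
      |2 * cos w - 2 * cos (w / N * (j + 1 : ℕ))| := by
    intro j hj
    have h1 : w / N * ((j + 1 : ℕ) : ℝ) ≤ B := by
      refine le_trans (mul_le_mul_of_nonneg_left ?_ hη.le) hk
      exact_mod_cast Finset.mem_range.1 hj
    refine le_trans (le_of_eq ?_) (hB _ (by positivity) h1)
    have e : w / N * ((j + 1 : ℕ) : ℝ) - φ = w / N * (((j + 1 : ℕ) : ℝ) - N * (φ / w)) := by
      field_simp
    rw [e, abs_mul, abs_of_pos hη]
    ring
  have hpos : ∀ j ∈ Finset.range k, 0 < |2 * cos w - 2 * cos (w / N * (j + 1 : ℕ))| := by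
    intro j hj
    refine lt_of_lt_of_le ?_ (hdist j hj)
    have := lt_of_lt_of_le hκ (hgood (j + 1))
    positivity
  have hlog : ∀ j ∈ Finset.range k, truncKernel (cos w) δ (w / N * (j + 1 : ℕ)) -
      log (max 1 (D * κ / |((j + 1 : ℕ) : ℝ) - N * (φ / w)|)) ≤
      log |2 * cos w - 2 * cos (w / N * (j + 1 : ℕ))| := by
    intro j hj
    have h1 := hpos j hj
    have h2 : 0 < |((j + 1 : ℕ) : ℝ) - N * (φ / w)| := lt_of_lt_of_le hκ (hgood (j + 1))
    have h3 := hdist j hj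
    rw [sub_le_iff_le_add, ← log_mul h1.ne' (lt_max_of_lt_left one_pos).ne', truncKernel]
    refine log_le_log (lt_max_of_lt_right hδ) (max_le ?_ ?_)
    · exact le_mul_of_one_le_right h1.le (le_max_left _ _)
    · have e : δ = w / N * c₀ * |((j + 1 : ℕ) : ℝ) - N * (φ / w)| *
          (D * κ / |((j + 1 : ℕ) : ℝ) - N * (φ / w)|) := by
        generalize |((j + 1 : ℕ) : ℝ) - N * (φ / w)| = z at h2
        rw [hδd, hD]
        field_simp
      calc δ = _ := e
        _ ≤ _ := mul_le_mul h3 (le_max_right _ _) (by positivity) h1.le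
  have hsum := Finset.sum_le_sum hlog
  rw [Finset.sum_sub_distrib] at hsum
  have hloss : ∑ j ∈ Finset.range k, log (max 1 (D * κ / |((j + 1 : ℕ) : ℝ) - N * (φ / w)|)) ≤
      2 * D := by
    have h := sum_log_max_one_div_abs_sub_le hD0 hκ hκ1 hgood (k + 1)
    rw [Finset.sum_range_succ'] at h
    have h0 : 0 ≤ log (max 1 (D * κ / |((0 : ℕ) : ℝ) - N * (φ / w)|)) :=
      log_nonneg (le_max_left _ _)
    linarith
  rw [← exp_log (Finset.prod_pos hpos), exp_le_exp, log_prod fun j hj => (hpos j hj).ne']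
  have h2 := (abs_le.1 (abs_sum_sub_integral_le hη.le (abs_truncKernel_sub_le (c := cos w) hδ)
    (continuous_truncKernel hδ) k)).1
  have h3 := logPrimitive_le_integral_truncKernel (w := w) (y := w / N * k) hδ (by positivity)
  rw [← Finset.mul_sum] at h2
  have h4 : 2 / δ * (w / N) ^ 2 * k ≤ 2 / δ * w * (w / N) := by
    calc 2 / δ * (w / N) ^ 2 * k = 2 / δ * (w / N) * (w / N * k) := by ring
      _ ≤ 2 / δ * (w / N) * w := mul_le_mul_of_nonneg_left hηk (by positivity)
      _ = _ := by ring
  have h5 : w / N * (N / w * logPrimitive (cos w) (w / N * k) - 2 / δ * w) ≤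
      w / N * ∑ j ∈ Finset.range k, truncKernel (cos w) δ (w / N * (j + 1 : ℕ)) := by
    have e : w / N * (N / w * logPrimitive (cos w) (w / N * k) - 2 / δ * w) =
      logPrimitive (cos w) (w / N * k) - 2 / δ * w * (w / N) := by
      field_simp
    rw [e]; linarith
  have h6 := le_of_mul_le_mul_left h5 hη
  have h7 : N / w * (logPrimitive (cos w) (w / N * k) - ε) =
      N / w * logPrimitive (cos w) (w / N * k) - 2 * D := by rw [hD]; ring
  rw [h7]
  linarith

end RiemannSums

/-! ### Two-sided exponential bounds for the sum. -/

section Asymptotics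

open Real Filter Topology

/-- Jordan's inequality, applied to π - v beyond π/2; the slope 2/(3π) is what the reflected line
allows at v = 3π/4. -/
theorem two_div_mul_le_sin {v : ℝ} (h0 : 0 ≤ v) (h1 : v ≤ 3 * π / 4) :
    2 / (3 * π) * v ≤ sin v := by
  have hp := pi_pos
  rcases le_total v (π / 2) with h | h
  · refine le_trans ?_ (mul_le_sin h0 h)
    exact mul_le_mul_of_nonneg_right
      (div_le_div_of_nonneg_left zero_le_two hp (by linarith)) h0
  · rw [← sin_pi_sub]
    refine le_trans ?_ (mul_le_sin (by linarith) (by linarith))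
    rw [div_mul_eq_mul_div, div_mul_eq_mul_div, div_le_div_iff₀ (by positivity) hp]
    nlinarith

/-- Away from its second zero, the kernel argument vanishes at most linearly. -/
theorem exists_mul_abs_sub_le {φ θ : ℝ} (h0 : 0 < φ) (h1 : φ < θ) (h2 : φ ≤ π / 2)
    (h3 : π / 2 ≤ θ) (h4 : θ ≤ π) :
    ∃ c₀, 0 < c₀ ∧ ∀ y, 0 ≤ y → y ≤ 2 * π - θ → c₀ * |y - φ| ≤ |2 * cos φ - 2 * cos y| := by
  have hp := pi_pos
  -- The values of sine at the ends of [φ/2, π - (θ - φ)/2], the range of (φ + y)/2.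
  set m := min (sin (φ / 2)) (sin ((θ - φ) / 2)) with hm
  have hm0 : 0 < m := lt_min (sin_pos_of_pos_of_lt_pi (by linarith) (by linarith))
    (sin_pos_of_pos_of_lt_pi (by linarith) (by linarith))
  refine ⟨4 * m / (3 * π), by positivity, fun y hy hy1 => ?_⟩
  have hs : m ≤ sin ((φ + y) / 2) := by
    rcases le_total ((φ + y) / 2) (π / 2) with h | h
    · exact (min_le_left _ _).trans
        (sin_le_sin_of_le_of_le_pi_div_two (by linarith) h (by linarith))
    · refine (min_le_right _ _).trans ?_
      rw [← sin_pi_sub ((φ + y) / 2)]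
      exact sin_le_sin_of_le_of_le_pi_div_two (by linarith) (by linarith) (by linarith)
  have hd : |y - φ| ≤ 3 * π / 2 := abs_le.2 ⟨by linarith, by linarith⟩
  have hv : 2 / (3 * π) * (|y - φ| / 2) ≤ |sin ((φ - y) / 2)| := by
    refine (two_div_mul_le_sin (by positivity) (by linarith)).trans ?_
    rcases abs_cases (y - φ) with ⟨h, _⟩ | ⟨h, _⟩
    · rw [h, show (φ - y) / 2 = -((y - φ) / 2) by ring, sin_neg, abs_neg]
      exact le_abs_self _
    · rw [h, neg_sub]
      exact le_abs_self _
  rw [two_mul_cos_sub_two_mul_cos, abs_neg, abs_mul, abs_mul, abs_mul, abs_two,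
    abs_of_pos (hm0.trans_le hs)]
  calc 4 * m / (3 * π) * |y - φ| = (2 * (2 / (3 * π) * (|y - φ| / 2))) * (2 * m) := by
        field_simp; ring
    _ ≤ _ := mul_le_mul (by linarith) (by linarith) (by positivity) (by positivity)

/-- The sum of partial products that gives the colored Jones polynomial at `exp (i w / N)`. -/
noncomputable def cosProdSum (w : ℝ) (N : ℕ) : ℝ :=
  ∑ k ∈ Finset.range N, ∏ j ∈ Finset.range k, (2 * cos w - 2 * cos (w / N * (j + 1 : ℕ)))

theorem prod_mul_prod_nonneg {f : ℕ → ℝ} {a b : ℕ} (hab : a ≤ b)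
    (h : ∀ j, a ≤ j → j < b → 0 ≤ f j) :
    0 ≤ (∏ j ∈ Finset.range a, f j) * ∏ j ∈ Finset.range b, f j := by
  obtain ⟨m, rfl⟩ := Nat.exists_eq_add_of_le hab
  rw [Finset.prod_range_add, ← mul_assoc]
  refine mul_nonneg (mul_self_nonneg _) (Finset.prod_nonneg fun i hi => h _ (by omega) ?_)
  have := Finset.mem_range.1 hi
  omega

theorem abs_le_abs_sum_of_mul_nonneg {ι : Type*} {s : Finset ι} {g : ι → ℝ} {b : ι} (hb : b ∈ s)
    (h : ∀ k ∈ s, 0 ≤ g b * g k) : |g b| ≤ |∑ k ∈ s, g k| := by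
  rcases eq_or_ne (g b) 0 with h0 | h0
  · rw [h0, abs_zero]; exact abs_nonneg _
  refine le_of_mul_le_mul_left ?_ (abs_pos.2 h0)
  rw [← abs_mul, ← abs_mul, Finset.mul_sum, abs_of_nonneg (mul_self_nonneg _)]
  exact (Finset.single_le_sum (f := fun k => g b * g k) h hb).trans (le_abs_self _)

theorem abs_cosProdSum_le {w P : ℝ} (hw : 0 < w)
    (hP : ∀ y, 0 ≤ y → y ≤ w → logPrimitive (cos w) y ≤ P) {ε : ℝ} (hε : 0 < ε) :
    ∃ C : ℝ, ∀ N : ℕ, 0 < N → |cosProdSum w N| ≤ N * exp (N / w * (P + ε) + C) := by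
  obtain ⟨C, hC⟩ := exists_prod_le_exp w hw hε
  refine ⟨C, fun N hN => ?_⟩
  have hN' : (0 : ℝ) < N := by exact_mod_cast hN
  refine (Finset.abs_sum_le_sum_abs _ _).trans ?_
  calc _ ≤ ∑ k ∈ Finset.range N, exp (N / w * (P + ε) + C) := by
        refine Finset.sum_le_sum fun k hk => ?_
        have hk' := (Finset.mem_range.1 hk).le
        rw [Finset.abs_prod]
        refine (hC N hN k hk').trans (exp_le_exp.2 ?_)
        have : w / N * k ≤ w := by
          rw [div_mul_eq_mul_div, div_le_iff₀ hN']
          exact mul_le_mul_of_nonneg_left (by exact_mod_cast hk') hw.le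
        have := hP (w / N * k) (by positivity) this
        gcongr
    _ = _ := by rw [Finset.sum_const, Finset.card_range, nsmul_eq_mul]

theorem eventually_log_abs_cosProdSum_le {w P : ℝ} (hw : 0 < w) (hP0 : 0 ≤ P)
    (hP : ∀ y, 0 ≤ y → y ≤ w → logPrimitive (cos w) y ≤ P) {ε : ℝ} (hε : 0 < ε) :
    ∀ᶠ N : ℕ in atTop, log |cosProdSum w N| / N ≤ P / w + ε := by
  obtain ⟨C, hC⟩ := abs_cosProdSum_le hw hP (ε := w * (ε / 2)) (by positivity)
  have hlim : Tendsto (fun N : ℕ => (log N + C) / (N : ℝ)) atTop (𝓝 0) := by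
    have h1 : Tendsto (fun x : ℝ => log x / x) atTop (𝓝 0) :=
      isLittleO_log_id_atTop.tendsto_div_nhds_zero
    have h2 : Tendsto (fun x : ℝ => C / x) atTop (𝓝 0) := tendsto_id.const_div_atTop C
    have h3 := (h1.add h2).comp tendsto_natCast_atTop_atTop
    rw [add_zero] at h3
    refine h3.congr fun N => ?_
    simp [add_div]
  filter_upwards [eventually_gt_atTop 0, hlim.eventually (gt_mem_nhds (half_pos hε))] with N hN hN2
  have hN' : (0 : ℝ) < N := by exact_mod_cast hN
  rcases eq_or_ne (cosProdSum w N) 0 with h0 | h0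
  -- Here `log 0 = 0`, so the bound requires P ≥ 0.
  · rw [h0, abs_zero, log_zero, zero_div]; positivity
  have h1 := log_le_log (abs_pos.2 h0) (hC N hN)
  rw [log_mul hN'.ne' (exp_ne_zero _), log_exp] at h1
  have h2 : log |cosProdSum w N| / N ≤ (log N + C) / N + (P + w * (ε / 2)) / w := by
    rw [div_le_iff₀ hN']
    refine h1.trans (le_of_eq ?_)
    field_simp
    ring
  have h3 : (P + w * (ε / 2)) / w = P / w + ε / 2 := by field_simp
  linarith

/-- If Nα and (N + 1)α were both within 1/14 of integers, α would be within 1/7 of their difference,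
an integer strictly between 0 and 1. -/
theorem exists_good_index {α : ℝ} (h1 : 1 / 7 ≤ α) (h2 : α ≤ 6 / 7) (N₀ : ℕ) :
    ∃ N ≥ N₀, ∀ j : ℕ, 1 / 14 ≤ |(j : ℝ) - N * α| := by
  by_contra! h
  obtain ⟨j, hj⟩ := h N₀ le_rfl
  obtain ⟨k, hk⟩ := h (N₀ + 1) (Nat.le_succ _)
  rw [abs_lt] at hj hk
  push_cast at hk
  have a1 : (0 : ℝ) < k - j := by linarith [hj.1, hj.2, hk.1, hk.2]
  have a2 : (k : ℝ) - j < 1 := by linarith [hj.1, hj.2, hk.1, hk.2]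
  have b1 : j < k := by exact_mod_cast sub_pos.1 a1
  have b2 : k < j + 1 := by
    have : (k : ℝ) < j + 1 := by linarith
    exact_mod_cast this
  omega

theorem eventually_le_abs_cosProdSum {w φ θ P V κ c₀ : ℝ} (hw : 0 < w)
    (hφ0 : 0 < φ) (hφθ : φ < θ) (hθ : θ ≤ π) (hφc : cos φ = cos w)
    (hθw : 2 * π - θ < w) (hP : logPrimitive (cos w) (2 * π - θ) = P) (hVP : V < P)
    (hV : ∀ y, 0 ≤ y → y ≤ w → (y < φ ∨ 2 * π - φ < y) → logPrimitive (cos w) y ≤ V)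
    (hc₀ : 0 < c₀)
    (hB : ∀ y, 0 ≤ y → y ≤ 2 * π - θ → c₀ * |y - φ| ≤ |2 * cos w - 2 * cos y|)
    (hκ : 0 < κ) (hκ1 : κ ≤ 1) {ε : ℝ} (hε : 0 < ε) :
    ∀ᶠ N : ℕ in atTop, (∀ j : ℕ, κ ≤ |(j : ℝ) - N * (φ / w)|) →
      exp (N / w * (P - ε)) ≤ |cosProdSum w N| := by
  have hp := pi_pos
  -- The main term has exponent P - 2e and the rest V + e ≤ P - 3e; the gap e absorbs the factor N
  -- and the constants.
  obtain ⟨e, he0, heε, heV⟩ : ∃ e, 0 < e ∧ 3 * e ≤ ε ∧ 4 * e ≤ P - V :=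
    ⟨min (ε / 3) ((P - V) / 4), lt_min (by linarith) (by linarith),
      by linarith [min_le_left (ε / 3) ((P - V) / 4)],
      by linarith [min_le_right (ε / 3) ((P - V) / 4)]⟩
  obtain ⟨C₁, hC₁⟩ := exists_exp_le_prod w hw hc₀ hκ hκ1 hθw.le hB he0
  obtain ⟨C₂, hC₂⟩ := exists_prod_le_exp w hw he0
  obtain ⟨d, hd0, hd⟩ : ∃ d > 0, ∀ y, |y - (2 * π - θ)| < d → P - e < logPrimitive (cos w) y := by
    have h := (continuous_logPrimitive (cos w)).tendsto (2 * π - θ)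
    rw [hP] at h
    obtain ⟨d, hd0, hd⟩ := Metric.eventually_nhds_iff.1 (h.eventually (lt_mem_nhds
      (show P - e < P by linarith)))
    exact ⟨d, hd0, fun y hy => hd (by rwa [Real.dist_eq])⟩
  have hη : Tendsto (fun N : ℕ => w / (N : ℝ)) atTop (𝓝 0) :=
    tendsto_const_div_atTop_nhds_zero_nat w
  have hgap : 0 < min d (2 * π - θ - φ) := lt_min hd0 (by linarith)
  have hbig : ∀ᶠ N : ℕ in atTop, 1 + N * exp C₂ ≤ exp (e / w * N - C₁) := by
    have h1 := (isLittleO_pow_exp_pos_mul_atTop 1 (div_pos he0 hw)).comp_tendsto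
      tendsto_natCast_atTop_atTop
    have h2 : 0 < exp (-C₁) / (1 + exp C₂) := by positivity
    filter_upwards [h1.def h2, eventually_ge_atTop 1] with N hN hN1
    have hN1' : (1 : ℝ) ≤ N := by exact_mod_cast hN1
    simp only [Function.comp_apply, pow_one, norm_eq_abs, Nat.abs_cast, abs_exp] at hN
    rw [div_mul_eq_mul_div, le_div_iff₀ (by positivity), ← exp_add, neg_add_eq_sub] at hN
    nlinarith [exp_pos C₂]
  filter_upwards [eventually_gt_atTop 0, hη.eventually (gt_mem_nhds hgap), hbig]
    with N hN hNη hNbig hgood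
  have hN' : (0 : ℝ) < N := by exact_mod_cast hN
  have hη0 : 0 < w / N := by positivity
  obtain ⟨g, hg⟩ : ∃ g : ℕ → ℝ, ∀ k, g k =
    ∏ j ∈ Finset.range k, (2 * cos w - 2 * cos (w / N * (j + 1 : ℕ))) := ⟨_, fun _ => rfl⟩
  have hgabs : ∀ k, |g k| =
      ∏ j ∈ Finset.range k, |2 * cos w - 2 * cos (w / N * (j + 1 : ℕ))| := fun k => by
    rw [hg, Finset.abs_prod]
  -- The last sample point not beyond 2π - θ: the product up to b stays where `hB` controls the
  -- factors.
  set b := ⌊(2 * π - θ) / (w / N)⌋₊ with hb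
  have hb1 : w / N * b ≤ 2 * π - θ := by
    rw [mul_comm, ← le_div_iff₀ hη0]
    exact Nat.floor_le (div_nonneg (by linarith) hη0.le)
  have hb2 : 2 * π - θ - w / N < w / N * b := by
    have := Nat.lt_floor_add_one ((2 * π - θ) / (w / N))
    rw [div_lt_iff₀ hη0, ← hb, add_mul, mul_comm (b : ℝ)] at this
    linarith
  have hbN : b < N := by
    have h1 : w / N * b < w / N * N := by
      rw [div_mul_cancel₀ _ hN'.ne']; linarith
    exact_mod_cast lt_of_mul_lt_mul_left h1 hη0.le
  have hsplit : cosProdSum w N =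
      ∑ k ∈ (Finset.range N).filter (fun k : ℕ => φ ≤ w / N * k ∧ w / N * k ≤ 2 * π - φ), g k +
      ∑ k ∈ (Finset.range N).filter (fun k : ℕ => ¬ (φ ≤ w / N * k ∧ w / N * k ≤ 2 * π - φ)), g k := by
    rw [Finset.sum_filter_add_sum_filter_not, cosProdSum]
    exact Finset.sum_congr rfl fun k _ => (hg k).symm
  have hsign : ∀ k l : ℕ, φ ≤ w / N * k → w / N * l ≤ 2 * π - φ → k ≤ l → 0 ≤ g k * g l := by
    intro k l hk hl hkl
    rw [hg, hg]
    refine prod_mul_prod_nonneg hkl fun j hj1 hj2 => ?_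
    have h1 : φ ≤ w / N * (j + 1 : ℕ) := hk.trans
      (mul_le_mul_of_nonneg_left (by exact_mod_cast hj1.trans (Nat.le_succ j)) hη0.le)
    have h2 : w / N * (j + 1 : ℕ) ≤ 2 * π - φ := le_trans
      (mul_le_mul_of_nonneg_left (by exact_mod_cast hj2) hη0.le) hl
    have h3 : cos (w / N * (j + 1 : ℕ)) ≤ cos φ := by
      rcases le_total (w / N * (j + 1 : ℕ)) π with h | h
      · exact cos_le_cos_of_nonneg_of_le_pi hφ0.le h h1
      · rw [← cos_two_pi_sub (w / N * (j + 1 : ℕ))]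
        exact cos_le_cos_of_nonneg_of_le_pi hφ0.le (by linarith) (by linarith)
    linarith
  have hmain : |g b| ≤
      |∑ k ∈ (Finset.range N).filter (fun k : ℕ => φ ≤ w / N * k ∧ w / N * k ≤ 2 * π - φ), g k| := by
    have hφb : φ ≤ w / N * b := by linarith [min_le_right d (2 * π - θ - φ)]
    have hbφ : w / N * b ≤ 2 * π - φ := by linarith
    refine abs_le_abs_sum_of_mul_nonneg
      (Finset.mem_filter.2 ⟨Finset.mem_range.2 hbN, hφb, hbφ⟩) fun k hk => ?_
    obtain ⟨_, hk1, hk2⟩ := Finset.mem_filter.1 hk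
    rcases le_total b k with h | h
    · exact hsign b k hφb hk2 h
    · rw [mul_comm]; exact hsign k b hk1 hbφ h
  have hrest : |∑ k ∈ (Finset.range N).filter
      (fun k : ℕ => ¬ (φ ≤ w / N * k ∧ w / N * k ≤ 2 * π - φ)), g k| ≤
      N * exp (N / w * (V + e) + C₂) := by
    refine (Finset.abs_sum_le_sum_abs _ _).trans ?_
    calc _ ≤ ∑ k ∈ (Finset.range N).filter
          (fun k : ℕ => ¬ (φ ≤ w / N * k ∧ w / N * k ≤ 2 * π - φ)), exp (N / w * (V + e) + C₂) := by
          refine Finset.sum_le_sum fun k hk => ?_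
          obtain ⟨hk1, hk2⟩ := Finset.mem_filter.1 hk
          have hkN := (Finset.mem_range.1 hk1).le
          have hkw : w / N * k ≤ w := by
            rw [div_mul_eq_mul_div, div_le_iff₀ hN']
            exact mul_le_mul_of_nonneg_left (by exact_mod_cast hkN) hw.le
          have hy : w / N * k < φ ∨ 2 * π - φ < w / N * k := by
            by_contra! h'
            exact hk2 h'
          have h1 := hV _ (by positivity) hkw hy
          rw [hgabs]
          refine (hC₂ N hN k hkN).trans (exp_le_exp.2 ?_)
          gcongr
      _ ≤ _ := by
          rw [Finset.sum_const, nsmul_eq_mul]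
          refine mul_le_mul_of_nonneg_right ?_ (exp_pos _).le
          exact_mod_cast (Finset.card_filter_le _ _).trans (Finset.card_range N).le
  have hgb : exp (N / w * (P - 2 * e) - C₁) ≤ |g b| := by
    rw [hgabs]
    refine le_trans (exp_le_exp.2 ?_) (hC₁ N hN hgood b hb1)
    have := hd (w / N * b) (by
      rw [abs_lt]; constructor <;> linarith [min_le_left d (2 * π - θ - φ)])
    have h2 : P - 2 * e ≤ logPrimitive (cos w) (w / N * b) - e := by linarith
    gcongr
  have hfin : exp (N / w * (P - 3 * e)) + N * exp (N / w * (V + e) + C₂) ≤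
      exp (N / w * (P - 2 * e) - C₁) := by
    have e1 : exp (N / w * (P - 2 * e) - C₁) = exp (N / w * (P - 3 * e)) * exp (e / w * N - C₁) := by
      rw [← exp_add]; congr 1; ring
    have e2 : exp (N / w * (V + e) + C₂) ≤ exp (N / w * (P - 3 * e)) * exp C₂ := by
      rw [exp_add]
      refine mul_le_mul_of_nonneg_right (exp_le_exp.2 ?_) (exp_pos _).le
      have : V + e ≤ P - 3 * e := by linarith
      gcongr
    rw [e1]
    calc _ ≤ exp (N / w * (P - 3 * e)) + N * (exp (N / w * (P - 3 * e)) * exp C₂) := by gcongr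
      _ = exp (N / w * (P - 3 * e)) * (1 + N * exp C₂) := by ring
      _ ≤ _ := mul_le_mul_of_nonneg_left hNbig (exp_pos _).le
  have hle : exp (N / w * (P - ε)) ≤ exp (N / w * (P - 3 * e)) := by
    refine exp_le_exp.2 ?_
    have : P - ε ≤ P - 3 * e := by linarith
    gcongr
  rw [hsplit]
  have htri := abs_sub_abs_le_abs_sub
    (∑ k ∈ (Finset.range N).filter (fun k : ℕ => φ ≤ w / N * k ∧ w / N * k ≤ 2 * π - φ), g k)
    (-∑ k ∈ (Finset.range N).filter (fun k : ℕ => ¬ (φ ≤ w / N * k ∧ w / N * k ≤ 2 * π - φ)), g k)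
  rw [abs_neg, sub_neg_eq_add] at htri
  linarith

end Asymptotics

theorem mainTheorem3 (r : ℝ) (hr : Irrational r) (h1 : 1 / 6 ≤ |1 - r|) (h2 : |1 - r| < 1 / 4) :
    Filter.limsup
      (fun N : ℕ =>
        ((2 * Real.pi *
          (Real.log ‖ColoredJones.figureEight N
            (Complex.exp (2 * Real.pi * r * Complex.I / N))‖ / N) : ℝ) : EReal))
      Filter.atTop
    = (((2 * lobachevsky (Real.pi * r + coneTheta r / 2)
          - 2 * lobachevsky (Real.pi * r - coneTheta r / 2)) / r : ℝ) : EReal) := by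
  have hp := Real.pi_pos
  have habs := abs_lt.1 h2
  have hr0 : 0 < r := by linarith
  set w : ℝ := 2 * Real.pi * r with hw
  have hw0 : 0 < w := by positivity
  set φ : ℝ := 2 * Real.pi * |1 - r| with hφ
  have h1' : 1 / 6 < |1 - r| := by
    -- Equality would mean r = 5/6 or r = 7/6. Strictness yields cos w < 1/2.
    refine lt_of_le_of_ne h1 fun h => ?_
    rcases abs_cases (1 - r) with ⟨h3, _⟩ | ⟨h3, _⟩
    · exact hr ⟨5 / 6, by push_cast; linarith⟩
    · exact hr ⟨7 / 6, by push_cast; linarith⟩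
  have hφ1 : Real.pi / 3 < φ := by rw [hφ]; nlinarith
  have hφ2 : φ < Real.pi / 2 := by rw [hφ]; nlinarith
  have hφc : Real.cos φ = Real.cos w := by
    rw [hφ, hw]
    rcases abs_cases (1 - r) with ⟨h3, _⟩ | ⟨h3, _⟩
    · rw [h3, ← Real.cos_two_pi_sub]; congr 1; ring
    · rw [h3, ← Real.cos_add_two_pi]; congr 1; ring
  have hc0 : 0 < Real.cos w := by
    rw [← hφc]; exact Real.cos_pos_of_mem_Ioo ⟨by linarith, hφ2⟩
  have hc1 : Real.cos w < 1 / 2 := by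
    rw [← hφc, ← Real.cos_pi_div_three]
    exact Real.cos_lt_cos_of_nonneg_of_le_pi (by linarith) (by linarith) hφ1
  have hφa : Real.arccos (Real.cos w) = φ := by
    rw [← hφc]; exact Real.arccos_cos (by linarith) (by linarith)
  obtain ⟨V, hV0, hVP, hP, hV⟩ := exists_logPrimitive_bounds hc0 hc1
  rw [hφa] at hV
  set θ := coneTheta r with hθ
  have hθ' : Real.arccos (Real.cos w - 1 / 2) = θ := rfl
  rw [hθ'] at hVP hP
  set P := -logPrimitive (Real.cos w) θ with hPdef
  have hθ1 : Real.pi / 2 < θ := by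
    rw [← hθ']
    exact lt_of_not_ge fun h => by linarith [Real.arccos_le_pi_div_two.1 h]
  have hθ2 : θ ≤ Real.pi := Real.arccos_le_pi _
  have hw1 : 3 * Real.pi / 2 < w := by rw [hw]; nlinarith
  have hw2 : w ≤ 5 * Real.pi / 2 := by rw [hw]; nlinarith
  have hT : (2 * lobachevsky (Real.pi * r + θ / 2) - 2 * lobachevsky (Real.pi * r - θ / 2)) / r =
      2 * Real.pi * (P / w) := by
    rw [hPdef, logPrimitive_cos, show (w - θ) / 2 = Real.pi * r - θ / 2 by rw [hw]; ring,
      show (w + θ) / 2 = Real.pi * r + θ / 2 by rw [hw]; ring, hw]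
    field_simp
    ring
  have hnorm : ∀ N : ℕ, 0 < N → ‖ColoredJones.figureEight N
      (Complex.exp (2 * Real.pi * r * Complex.I / N))‖ = |cosProdSum w N| := by
    intro N hN
    rw [ColoredJones.figureEight_exp_eq hr hN, Complex.norm_real, Real.norm_eq_abs]
    rfl
  rw [hT]
  refine le_antisymm ?_ ?_
  · refine EReal.le_of_forall_lt_iff_le.1 fun z hz => ?_
    have hz' : 2 * Real.pi * (P / w) < z := by exact_mod_cast hz
    refine Filter.limsup_le_of_le (by isBoundedDefault) ?_
    filter_upwards [Filter.eventually_gt_atTop 0,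
      eventually_log_abs_cosProdSum_le hw0 (hV0.trans hVP.le)
        (fun y hy hy1 => hP y hy (hy1.trans hw2))
        (ε := (z - 2 * Real.pi * (P / w)) / (2 * Real.pi))
        (div_pos (by linarith) (by positivity))] with N hN hN2
    rw [hnorm N hN]
    have h3 := mul_le_mul_of_nonneg_left hN2 (show 0 ≤ 2 * Real.pi by positivity)
    rw [mul_add, mul_div_cancel₀ _ (by positivity)] at h3
    exact_mod_cast (by linarith)
  · refine EReal.ge_of_forall_gt_iff_ge.1 fun z hz => ?_
    have hz' : z < 2 * Real.pi * (P / w) := by exact_mod_cast hz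
    obtain ⟨c₀, hc₀, hB⟩ := exists_mul_abs_sub_le (φ := φ) (θ := θ) (by linarith) (by linarith)
      hφ2.le hθ1.le hθ2
    rw [hφc] at hB
    have hev := eventually_le_abs_cosProdSum (κ := 1 / 14) hw0 (by linarith) (by linarith) hθ2
      hφc (by linarith) (logPrimitive_cos_two_pi_sub w θ) hVP
      (fun y hy hy1 => hV y hy (hy1.trans hw2)) hc₀ hB (by norm_num) (by norm_num)
      (ε := w * ((2 * Real.pi * (P / w) - z) / (2 * Real.pi)))
      (mul_pos hw0 (div_pos (by linarith) (by positivity)))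
    have hα : φ / w = |1 - r| / r := by rw [hφ, hw]; field_simp
    -- The value 1/7 corresponds to r = 7/6, the worst case for |1 - r|/r.
    have hα1 : 1 / 7 ≤ φ / w := by
      rw [hα, div_le_div_iff₀ (by norm_num) hr0]
      rcases abs_cases (1 - r) with ⟨h3, _⟩ | ⟨h3, _⟩ <;> linarith
    have hα2 : φ / w ≤ 6 / 7 := by
      rw [hα, div_le_div_iff₀ hr0 (by norm_num)]; linarith
    have hfreq : ∃ᶠ N : ℕ in Filter.atTop, ∀ j : ℕ, 1 / 14 ≤ |(j : ℝ) - N * (φ / w)| :=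
      Filter.frequently_atTop.2 fun N₀ => exists_good_index hα1 hα2 N₀
    refine Filter.le_limsup_of_frequently_le ?_ (by isBoundedDefault)
    refine (hfreq.and_eventually (hev.and (Filter.eventually_gt_atTop 0))).mono ?_
    rintro N ⟨hgood, hN, hN0⟩
    rw [hnorm N hN0]
    have hN' : (0 : ℝ) < N := by exact_mod_cast hN0
    have h3 := Real.log_le_log (Real.exp_pos _) (hN hgood)
    rw [Real.log_exp] at h3
    have h4 : z / (2 * Real.pi) ≤ Real.log |cosProdSum w N| / N := by
      rw [le_div_iff₀ hN']
      refine le_trans (le_of_eq ?_) h3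
      field_simp
      ring
    rw [div_le_iff₀' (by positivity)] at h4
    exact_mod_cast h4
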